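/- Let $n\ge 2$, $G=\mathrm{SL}(n,\mathbb R)$, let $k\ge 1$ and let $n-1\ge m_1>m_2>\dots>m_k\ge 1$ be integers. Write $E_{i,j}$ for the elementary $n\times n$ matrices, and for $1\le \ell\le k$ put $$\mathcal A_\ell=m_\ell E_{1,1}-\sum_{j=2}^{m_\ell+1}E_{j,j},\qquad \mathcal A(t)=t_1\mathcal A_1+\dots+t_k\mathcal A_k\quad (t=(t_1,\dots,t_k)\in\mathbb R^k).$$ Let $\mathcal T=(t_i)_{i}$ be a sequence in $[0,\infty)^k$ each of whose coordinates tends to $\infty$ as $i\to\infty$. For $e\in\mathbb R^{n-1}$ let $u(e)\in G$ be the matrix with first row $(1,e)$ whose other rows are those of the identity matrix. Let $V$ be a finite-dimensional real vector space with a continuous linear representation of $G$. Put $$V^{-}(\mathcal T)=\{v\in V:\exp(\mathcal A(t_i))v\to 0\},\qquad V^{+}(\mathcal T)=\{v\in V:\exp(-\mathcal A(t_i))v\to 0\},$$ $$V^{0}(\mathcal T)=\{v\in V:\exp(\mathcal A(t_i))v\text{ and }\exp(-\mathcal A(t_i))v\text{ both converge in }V\},$$ and assume that $V=V^+(\mathcal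 T)\oplus V^0(\mathcal T)\oplus V^-(\mathcal T)$ (this always holds after passing to a subsequence of $\mathcal T$). Let $\pi_0^{\mathcal T}:V\to V^0(\mathcal T)$ be the corresponding projection. For $\mu\in\mathbb R^k$ let $V_\mu=\{v\in V:\mathcal A_\ell v=\mu_\ell v,\ 1\le \ell\le k\}$, where the Lie algebra of $G$ acts on $V$ by the derivative of the representation. Then $V$ is the direct sum of the nonzero $V_\mu$; let $\pi_{\mathbf 0}^{\mathcal T}:V\to V_{\mathbf 0}$ be the projection onto $V_{\mathbf 0}$ along $\sum_{\nu\ne \mathbf 0}V_\nu$. Let $\mathcal B$ be an affine basis of $\mathbb R^{n-1}$ and let $v\in V$, $v\neq 0$, be such that $$u(e)v\in V^0(\mathcal T)+V^-(\mathcal T)\qquad\text{for all } e\in\mathcal B.$$ Then $\pi_{\mathbf 0}^{\mathcal T}(u(e)v)\ne 0$ and $\pi_0^{\mathcal T}(u(e)v)\neq 0$ for all $e\in\mathcal B$. -/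

import Mathlib

open scoped MatrixGroups

noncomputable section

namespace Layered

variable {d k : ℕ}

/-- The unipotent matrix `u(e)` in `SL(d+1, ℝ)`: its first row is `(1, e₁, …, e_d)`, and its other
rows are those of the identity matrix. -/
def u (e : Fin d → ℝ) : SL(d + 1, ℝ) :=
  ⟨Matrix.of (Fin.cons (Fin.cons 1 e) fun i => Pi.single i.succ 1), by
    rw [Matrix.det_of_isUpperTriangular, Fin.prod_univ_succ]
    · simp
    · intro i j hij
      induction i using Fin.cases with
      | zero => exact absurd hij (Fin.not_lt_zero _)
      | succ i => exact Pi.single_eq_of_ne (M := fun _ => ℝ) (ne_of_lt hij) 1⟩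

/-- The matrix `p E₁₁ - ∑_{j=2}^{p+1} E_{jj}` of size `(d+1) × (d+1)`, for `0 ≤ p ≤ d`
(rows and columns are numbered from `0` here). -/
def layerMatrix (p : Fin (d + 1)) : Matrix (Fin (d + 1)) (Fin (d + 1)) ℝ :=
  ((p : ℕ) : ℝ) • Matrix.single 0 0 1 - ∑ j ∈ Finset.Ioc 0 p, Matrix.single j j 1

/-- `𝒜(t) = t₁ 𝒜₁ + ⋯ + t_k 𝒜_k`, where `𝒜_ℓ` is the layer matrix with parameter `m_ℓ`. -/
def layerSum (m : Fin k → Fin (d + 1)) (t : Fin k → ℝ) : Matrix (Fin (d + 1)) (Fin (d + 1)) ℝ :=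
  ∑ l, t l • layerMatrix (m l)

theorem layerMatrix_eq_diagonal (p : Fin (d + 1)) :
    ∃ x : Fin (d + 1) → ℝ, ∑ j, x j = 0 ∧ layerMatrix p = Matrix.diagonal x := by
  refine ⟨((p : ℕ) : ℝ) • Pi.single 0 1 - ∑ j ∈ Finset.Ioc 0 p, Pi.single j 1, ?_, ?_⟩
  · simp only [Pi.sub_apply, Pi.smul_apply, Finset.sum_apply, Finset.sum_sub_distrib, smul_eq_mul,
      ← Finset.mul_sum]
    rw [Finset.sum_comm]
    simp
  · ext a b
    simp only [layerMatrix, Matrix.sub_apply, Matrix.smul_apply, Matrix.sum_apply,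
      Matrix.diagonal_apply, Pi.sub_apply, Pi.smul_apply, Finset.sum_apply, Matrix.single_apply,
      Pi.single_apply]
    by_cases h : a = b
    · subst h
      simp [eq_comm]
    · have : ∀ j : Fin (d + 1), ¬ (j = a ∧ j = b) := fun j hj => h (hj.1.symm.trans hj.2)
      simp [h, this]

theorem det_exp_layerSum (m : Fin k → Fin (d + 1)) (t : Fin k → ℝ) :
    (NormedSpace.exp (layerSum m t)).det = 1 := by
  choose x hx hx' using fun p : Fin (d + 1) => layerMatrix_eq_diagonal p
  have h : layerSum m t = Matrix.diagonal (∑ l, t l • x (m l)) := by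
    rw [layerSum, ← Matrix.diagonalAddMonoidHom_apply, map_sum]
    exact Finset.sum_congr rfl fun l _ => by simp [hx', Matrix.diagonal_smul]
  rw [h, Matrix.exp_diagonal, Matrix.det_diagonal]
  simp only [Pi.coe_exp, ← Real.exp_eq_exp_ℝ, ← Real.exp_sum, Finset.sum_apply, Pi.smul_apply]
  rw [Finset.sum_comm]
  simp [← Finset.mul_sum, hx]

/-- The element `exp(𝒜(t))` of `SL(d+1, ℝ)`. -/
def expLayer (m : Fin k → Fin (d + 1)) (t : Fin k → ℝ) : SL(d + 1, ℝ) :=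
  ⟨NormedSpace.exp (layerSum m t), det_exp_layerSum m t⟩

section Representation

variable {V : Type*} [NormedAddCommGroup V] [NormedSpace ℝ V]

/-- `V⁻(𝒯)`: the vectors `v` with `exp(𝒜(t_i)) v → 0`. -/
def Vminus (ρ : Representation ℝ SL(d + 1, ℝ) V) (m : Fin k → Fin (d + 1))
    (T : ℕ → Fin k → ℝ) : Submodule ℝ V where
  carrier := {v | Filter.Tendsto (fun i => ρ (expLayer m (T i)) v) Filter.atTop (nhds 0)}
  add_mem' ha hb := by simpa using Filter.Tendsto.add ha hb
  zero_mem' := by simp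
  smul_mem' c v hv := by simpa using Filter.Tendsto.const_smul hv c

/-- `V⁺(𝒯)`: the vectors `v` with `exp(-𝒜(t_i)) v → 0`. -/
def Vplus (ρ : Representation ℝ SL(d + 1, ℝ) V) (m : Fin k → Fin (d + 1))
    (T : ℕ → Fin k → ℝ) : Submodule ℝ V :=
  Vminus ρ m fun i => -T i

/-- `V⁰(𝒯)`: the vectors `v` such that both `exp(𝒜(t_i)) v` and `exp(-𝒜(t_i)) v` converge. -/
def Vzero (ρ : Representation ℝ SL(d + 1, ℝ) V) (m : Fin k → Fin (d + 1))
    (T : ℕ → Fin k → ℝ) : Submodule ℝ V where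
  carrier := {v |
    (∃ x, Filter.Tendsto (fun i => ρ (expLayer m (T i)) v) Filter.atTop (nhds x)) ∧
    (∃ y, Filter.Tendsto (fun i => ρ (expLayer m (-T i)) v) Filter.atTop (nhds y))}
  add_mem' := by
    rintro a b ⟨⟨x, hx⟩, ⟨y, hy⟩⟩ ⟨⟨x', hx'⟩, ⟨y', hy'⟩⟩
    exact ⟨⟨x + x', by simpa using hx.add hx'⟩, ⟨y + y', by simpa using hy.add hy'⟩⟩
  zero_mem' := ⟨⟨0, by simp⟩, ⟨0, by simp⟩⟩
  smul_mem' := by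
    rintro c v ⟨⟨x, hx⟩, ⟨y, hy⟩⟩
    exact ⟨⟨c • x, by simpa using hx.const_smul c⟩, ⟨c • y, by simpa using hy.const_smul c⟩⟩

/-- The joint eigenspace `V_μ = {v : 𝒜_ℓ v = μ_ℓ v for all ℓ}`, where the Lie algebra acts through
the derivative at `s = 0` of the one-parameter group `s ↦ exp(s 𝒜_ℓ)`; here `s 𝒜_ℓ = 𝒜(t)` for
`t = (0, …, s, …, 0)`. -/
def weightSpace (ρ : Representation ℝ SL(d + 1, ℝ) V) (m : Fin k → Fin (d + 1))
    (μ : Fin k → ℝ) : Submodule ℝ V where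
  carrier := {v | ∀ l, HasDerivAt (fun s : ℝ => ρ (expLayer m (Pi.single l s)) v) (μ l • v) 0}
  add_mem' ha hb l := by simpa [Pi.add_def] using (ha l).add (hb l)
  zero_mem' l := by simpa using hasDerivAt_const (0 : ℝ) (0 : V)
  smul_mem' c v hv l := by
    simpa [Pi.smul_def, smul_comm (μ l) c v] using (hv l).const_smul c

open Classical in
/-- The projection onto `p` along `q`; it is `0` by convention if `p` and `q` are not
complementary. -/
def projAlong (p q : Submodule ℝ V) : V →ₗ[ℝ] V :=
  if h : IsCompl p q then p.projection q h else 0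

/-- The projection onto `V_μ` along the sum of the other joint eigenspaces. -/
def weightProj (ρ : Representation ℝ SL(d + 1, ℝ) V) (m : Fin k → Fin (d + 1))
    (μ : Fin k → ℝ) : V →ₗ[ℝ] V :=
  projAlong (weightSpace ρ m μ) (⨆ ν : {ν : Fin k → ℝ // ν ≠ μ}, weightSpace ρ m ν.1)

/-- The projection onto `V⁰(𝒯)` along `V⁺(𝒯) + V⁻(𝒯)`. -/
def neutralProj (ρ : Representation ℝ SL(d + 1, ℝ) V) (m : Fin k → Fin (d + 1))
    (T : ℕ → Fin k → ℝ) : V →ₗ[ℝ] V :=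
  projAlong (Vzero ρ m T) (Vplus ρ m T ⊔ Vminus ρ m T)

end Representation

end Layered

end

namespace Layered

/-! ### Diagonalizability of `h` in finite-dimensional real representations of `sl₂` -/

section SlTwo

open Polynomial Module.End

variable {V : Type*} [AddCommGroup V] [Module ℝ V]

/-! Number the affine basis as `E_0, …, E_d` with the point under study last, and let `M` in `SL`
have rows proportional to `(1, E_j)`. Decompose `M v` into weight vectors of the diagonal torus and
choose a weight `x` that occurs in it and maximizes `∑ c * x c`.

Let `B` be the space of vectors with bounded trajectory under `exp(𝒜(t_i))`; by hypothesis it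
contains every `u(E_j) v`. Row operations triangular for the row order `0, d, d-1, …, 1` have
convergent conjugates under `exp(𝒜(t_i))`, so they preserve `B`, and their limits centralize the
layers. Reducing `u(E_j) M⁻¹` by such an operation gives an echelon matrix with pivot permutation
`π_j` that sends `M v` into `B` (`exists_echelon`). Since `B` is invariant under the torus, this
matrix can be degenerated to a monomial one, which sends the `x`-component of `M v` to a nonzero
vector of `B` of weight `x ∘ π_j` (`exists_monomial_apply_mem`).

The first pivot is `π_j 0 = j`, so boundedness bounds from above a sum of terms `x j - x (π_j
(r+1))` with coefficients that tend to infinity on the rows of the layers. If `x j` is maximal, no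
term is negative, hence `x (π_j (r+1)) = x j` on those rows, and `x ∘ π_j` vanishes on every `𝒜_ℓ`.

The last coordinate of `x` is maximal. Otherwise, for each maximal `j` the last pivot lies below the
rows of the layers, which forces `E_j` to agree with `E_last` in the layer coordinates
(`agree_of_pivot_last`). A pivot of a layer row of a maximal `j` is again maximal, so its point
agrees with `E_j` there, which `pivot_ne_of_agree` excludes. If now `u(E_last) v` had no zero weight
component, the degeneration could be run inside the vectors of `B` without such a component, and it
would produce a nonzero vector of weight zero there: a contradiction.

The statement on `V⁰` follows, because vectors of `V⁻` have no zero weight component. Weight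
decompositions come from `sl₂`: continuous one-parameter groups are differentiable, each coroot
belongs to an `sl₂`-triple, and commuting diagonalizable operators have joint eigenvectors. -/

theorem mul_pow_of_lowering {A : Type*} [Ring A] [Algebra ℝ A] {h f : A}
    (hf : h * f - f * h = -((2 : ℝ) • f)) (i : ℕ) :
    h * f ^ i = f ^ i * h - (2 * i : ℝ) • f ^ i := by
  induction i with
  | zero => simp
  | succ i ih =>
    have h1 : h * f = f * h - (2 : ℝ) • f := by
      rw [sub_eq_iff_eq_add] at hf
      rw [hf]; abel
    calc h * f ^ (i + 1) = (h * f ^ i) * f := by rw [pow_succ, mul_assoc]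
      _ = f ^ i * (h * f) - (2 * i : ℝ) • f ^ (i + 1) := by
        rw [ih, sub_mul, mul_assoc, smul_mul_assoc, pow_succ]
      _ = _ := by
        rw [h1, mul_sub, ← mul_assoc, ← pow_succ, mul_smul_comm, ← pow_succ]
        push_cast
        module

theorem mul_pow_of_raising {A : Type*} [Ring A] [Algebra ℝ A] {h e : A}
    (he : h * e - e * h = (2 : ℝ) • e) (i : ℕ) :
    h * e ^ i = e ^ i * h + (2 * i : ℝ) • e ^ i := by
  have := mul_pow_of_lowering (h := -h) (f := e) (by rw [← he]; noncomm_ring) i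
  rw [neg_mul, mul_neg] at this
  rw [← neg_inj, this]
  abel

/-- A raising operator on a finite-dimensional space is nilpotent. -/
theorem isNilpotent_of_raising {A : Type*} [Ring A] [Algebra ℝ A] [FiniteDimensional ℝ A] {h e : A}
    (he : h * e - e * h = (2 : ℝ) • e) : IsNilpotent e := by
  by_contra hn
  let ad : Module.End ℝ A := LinearMap.mulLeft ℝ h - LinearMap.mulRight ℝ h
  have hev : ∀ i : ℕ, ad.HasEigenvalue (2 * i : ℝ) := fun i =>
    hasEigenvalue_of_hasEigenvector (x := e ^ i) ⟨by
      rw [mem_eigenspace_iff]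
      simp [ad, mul_pow_of_raising he], fun h0 => hn ⟨i, h0⟩⟩
  have hfin := finite_hasEigenvalue (f := ad)
  refine Set.infinite_of_injective_forall_mem (f := fun i : ℕ => (2 * i : ℝ)) ?_ hev hfin
  intro a b hab
  simpa using hab

variable {e f h : Module.End ℝ V}

theorem mul_pow_succ_of_bracket (hf : h * f - f * h = -((2 : ℝ) • f)) (hef : e * f - f * e = h)
    (i : ℕ) :
    e * f ^ (i + 1) = f ^ (i + 1) * e + ((i : ℝ) + 1) • (f ^ i * h - (i : ℝ) • f ^ i) := by
  have hef' : e * f = f * e + h := by rw [← hef]; abel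
  induction i with
  | zero => simp [hef']
  | succ i ih =>
    calc e * f ^ (i + 1 + 1) = (e * f ^ (i + 1)) * f := by rw [pow_succ f (i + 1), mul_assoc]
      _ = f ^ (i + 1) * (e * f) +
          ((i : ℝ) + 1) • (f ^ i * (h * f) - (i : ℝ) • f ^ (i + 1)) := by
        rw [ih, add_mul, smul_mul_assoc, sub_mul, mul_assoc, mul_assoc, smul_mul_assoc, pow_succ]
      _ = _ := by
        have h1 : h * f = f * h - (2 : ℝ) • f := by
          rw [sub_eq_iff_eq_add] at hf
          rw [hf]; abel
        rw [hef', h1, mul_add, mul_sub, ← mul_assoc, ← mul_assoc, ← pow_succ, ← pow_succ,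
          mul_smul_comm, ← pow_succ]
        push_cast
        module

/-- On `ker e`, the operator `e ^ m f ^ m` is a polynomial in `h`. -/
theorem pow_mul_pow_apply_of_primitive (hf : h * f - f * h = -((2 : ℝ) • f))
    (he : h * e - e * h = (2 : ℝ) • e) (hef : e * f - f * e = h) (m : ℕ) :
    ∀ u : V, e u = 0 → (e ^ m * f ^ m) u =
      (m.factorial : ℝ) • aeval h (∏ i ∈ Finset.range m, (X - C (i : ℝ))) u := by
  induction m with
  | zero => simp
  | succ m ih =>
    intro u hu
    have hu' : e (h u - (m : ℝ) • u) = 0 := by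
      have := LinearMap.congr_fun he u
      simp only [LinearMap.sub_apply, Module.End.mul_apply, hu, map_zero, zero_sub,
        LinearMap.smul_apply, smul_zero, neg_eq_zero] at this
      simp [this, hu]
    have h1 : (e ^ (m + 1) * f ^ (m + 1)) u =
        ((m : ℝ) + 1) • (e ^ m * f ^ m) (h u - (m : ℝ) • u) := by
      rw [pow_succ e, mul_assoc, mul_pow_succ_of_bracket hf hef]
      simp [hu, mul_apply]
    rw [h1, ih _ hu', smul_smul, Finset.prod_range_succ, map_mul, mul_apply, Nat.factorial_succ]
    simp only [map_sub, aeval_X, aeval_C, LinearMap.sub_apply,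
      Module.algebraMap_end_apply, map_smul, Nat.cast_mul, Nat.cast_succ]

/-- With `f ^ m = 0` the formula for `e ^ m f ^ m` makes a polynomial in `h` vanish on `ker e`. Its
roots `0, …, m-1` are simple, which gives both semisimplicity and natural weights there. -/
theorem aeval_apply_eq_zero_of_primitive (hf : h * f - f * h = -((2 : ℝ) • f))
    (he : h * e - e * h = (2 : ℝ) • e) (hef : e * f - f * e = h) {m : ℕ} (hm : f ^ m = 0)
    {u : V} (hu : e u = 0) :
    aeval h (∏ i ∈ Finset.range m, (X - C (i : ℝ))) u = 0 := by
  have := pow_mul_pow_apply_of_primitive hf he hef m u hu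
  rw [hm, mul_zero, LinearMap.zero_apply, eq_comm, smul_eq_zero] at this
  exact this.resolve_left (by positivity)

/-- A generalized eigenvector of `h` of order two that is killed by `e` is an eigenvector. -/
theorem apply_eq_of_primitive (hf : h * f - f * h = -((2 : ℝ) • f))
    (he : h * e - e * h = (2 : ℝ) • e) (hef : e * f - f * e = h) {m : ℕ} (hm : f ^ m = 0)
    {k : ℕ} {u w : V} (hu : e u = 0) (huw : h u - (k : ℝ) • u = w) (hw : h w = (k : ℝ) • w) :
    w = 0 := by
  -- If `k` is a root, the remaining factors act on `w` by a nonzero scalar; if not, the whole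
  -- polynomial does.
  by_cases hk : k ∈ Finset.range m
  · have h0 := aeval_apply_eq_zero_of_primitive hf he hef hm hu
    rw [← Finset.prod_erase_mul _ _ hk, map_mul, mul_apply] at h0
    have h1 : aeval h (X - C (k : ℝ)) u = w := by
      rw [← huw, map_sub, aeval_X, aeval_C, LinearMap.sub_apply, Module.algebraMap_end_apply]
    rw [h1, aeval_apply_of_mem_apply_eq_smul hw, smul_eq_zero] at h0
    refine h0.resolve_left ?_
    rw [eval_prod, ← ne_eq, Finset.prod_ne_zero_iff]
    intro i hi
    simp only [eval_sub, eval_X, eval_C, sub_ne_zero]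
    exact_mod_cast (Finset.ne_of_mem_erase hi).symm
  · have hew : e w = 0 := by
      rw [← huw]
      have := LinearMap.congr_fun he u
      simp only [LinearMap.sub_apply, Module.End.mul_apply, hu, map_zero, zero_sub,
        LinearMap.smul_apply, smul_zero, neg_eq_zero] at this
      simp [this, hu]
    have h0 := aeval_apply_eq_zero_of_primitive hf he hef hm hew
    rw [aeval_apply_of_mem_apply_eq_smul hw, smul_eq_zero] at h0
    refine h0.resolve_left ?_
    rw [eval_prod, ← ne_eq, Finset.prod_ne_zero_iff]
    intro i hi
    simp only [eval_sub, eval_X, eval_C, sub_ne_zero]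
    rintro h
    exact hk (by rw [Nat.cast_inj.mp h]; exact hi)

theorem exists_nat_of_primitive (hf : h * f - f * h = -((2 : ℝ) • f))
    (he : h * e - e * h = (2 : ℝ) • e) (hef : e * f - f * e = h) {m : ℕ} (hm : f ^ m = 0)
    {w : V} {μ : ℝ} (hw : h w = μ • w) (hew : e w = 0) (hw0 : w ≠ 0) : ∃ k : ℕ, μ = k := by
  have h0 := aeval_apply_eq_zero_of_primitive hf he hef hm hew
  rw [aeval_apply_of_mem_apply_eq_smul hw, smul_eq_zero] at h0
  have h1 := h0.resolve_right hw0
  rw [eval_prod, Finset.prod_eq_zero_iff] at h1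
  obtain ⟨k, -, hk⟩ := h1
  exact ⟨k, by simpa [sub_eq_zero] using hk⟩

/-- The coefficients of the extremal projector on vectors of weight `k`. -/
noncomputable def projCoeff (k : ℕ) : ℕ → ℝ
  | 0 => 1
  | i + 1 => -projCoeff k i / (((i : ℝ) + 1) * (k + i + 2))

/-- The operator `h` is semisimple on its real generalized eigenspaces. -/
theorem apply_eq_of_sub_sq_eq_zero (hf : h * f - f * h = -((2 : ℝ) • f))
    (he : h * e - e * h = (2 : ℝ) • e) (hef : e * f - f * e = h) {m : ℕ} (hm : f ^ m = 0)
    (r : ℕ) : ∀ (v : V) (μ : ℝ), (e ^ r) v = 0 →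
      h (h v - μ • v) = μ • (h v - μ • v) → h v = μ • v := by
  induction r with
  | zero =>
    intro v μ hv _
    have : v = 0 := by simpa using hv
    simp [this]
  | succ r ih =>
    intro v μ hv hvμ
    set w := h v - μ • v with hw
    have hhe : ∀ x, h (e x) = e (h x) + (2 : ℝ) • e x := fun x => by
      have := LinearMap.congr_fun he x
      simp only [LinearMap.sub_apply, Module.End.mul_apply, LinearMap.smul_apply] at this
      rw [← this]; abel
    have hew' : h (e v) - (μ + 2) • e v = e w := by
      rw [hhe, hw, map_sub, map_smul]; module
    have hev : h (e v) = (μ + 2) • e v := by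
      refine ih (e v) (μ + 2) (by rw [← mul_apply, ← pow_succ]; exact hv) ?_
      rw [hew', hhe, hvμ, map_smul]; module
    have hew : e w = 0 := by rw [← hew', hev, sub_self]
    suffices w = 0 by rwa [hw, sub_eq_zero] at this
    by_contra hw0
    -- A nonzero `w` is primitive, so its weight is natural; this keeps the denominators of
    -- `projCoeff` away from zero.
    obtain ⟨k, rfl⟩ := exists_nat_of_primitive hf he hef hm hvμ hew hw0
    set x : ℕ → V := fun i => (e ^ i) v with hx
    have hxs : ∀ i, e (x i) = x (i + 1) := fun i => by
      simp only [hx, pow_succ' e i, mul_apply]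
    have hxw : ∀ i, h (x (i + 1)) = (k + 2 * (i + 1) : ℝ) • x (i + 1) := by
      intro i
      induction i with
      | zero => rw [← hxs]; simpa [hx] using hev
      | succ i ihi =>
        rw [← hxs, hhe, ihi, map_smul]
        push_cast
        module
    have hxr : x (r + 1) = 0 := hv
    have hfx : ∀ i, e ((f ^ (i + 1)) (x (i + 1))) = (f ^ (i + 1)) (x (i + 2)) +
        (((i : ℝ) + 1) * (k + i + 2)) • (f ^ i) (x (i + 1)) := by
      intro i
      have := LinearMap.congr_fun (mul_pow_succ_of_bracket hf hef i) (x (i + 1))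
      simp only [mul_apply, LinearMap.add_apply, LinearMap.smul_apply, LinearMap.sub_apply, hxs,
        hxw, map_smul] at this
      rw [this]
      module
    -- The extremal projector applied to `v`. Its image under `e` telescopes to zero, and all terms
    -- except `v` itself are true eigenvectors of weight `k`, so `h - k` maps it to `w`.
    let u : V := ∑ i ∈ Finset.range (r + 1), projCoeff k i • (f ^ i) (x i)
    have hu : e u = 0 := by
      have key : ∀ n, e (∑ i ∈ Finset.range (n + 1), projCoeff k i • (f ^ i) (x i)) =
          projCoeff k n • (f ^ n) (x (n + 1)) := by
        intro n
        induction n with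
        | zero => simp [hxs, projCoeff]
        | succ n ihn =>
          rw [Finset.sum_range_succ, map_add, ihn, map_smul, hfx, smul_add, smul_smul]
          have hc : projCoeff k (n + 1) * (((n : ℝ) + 1) * (k + n + 2)) = -projCoeff k n := by
            have : ((n : ℝ) + 1) * (k + n + 2) ≠ 0 := by positivity
            rw [projCoeff]
            field_simp
          rw [hc]
          module
      rw [key, hxr, map_zero, smul_zero]
    have huw : h u - (k : ℝ) • u = w := by
      have hterm : ∀ i, h ((f ^ (i + 1)) (x (i + 1))) = (k : ℝ) • (f ^ (i + 1)) (x (i + 1)) := by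
        intro i
        have := LinearMap.congr_fun (mul_pow_of_lowering hf (i + 1)) (x (i + 1))
        simp only [mul_apply, LinearMap.smul_apply, LinearMap.sub_apply, hxw, map_smul] at this
        rw [this]
        push_cast
        module
      simp only [u]
      rw [Finset.sum_range_succ']
      simp only [map_add, map_sum, map_smul, hterm, smul_add, Finset.smul_sum, pow_zero,
        one_apply]
      simp only [projCoeff, one_smul, smul_comm (k : ℝ)]
      simp only [hw, hx, pow_zero, one_apply]
      abel
    exact hw0 (apply_eq_of_primitive hf he hef hm hu huw hvμ)

/-- On a sum of eigenspaces, `h - μ` is invertible away from the eigenvalue `μ`. Subtracting a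
suitable `y` from `v` thus leaves `(h - μ)(v - y)` in the `μ`-eigenspace, and `hss` makes `v - y` an
eigenvector. -/
theorem mem_iSup_eigenspace_of_apply_sub {h : Module.End ℝ V}
    (hss : ∀ (v : V) (μ : ℝ), h (h v - μ • v) = μ • (h v - μ • v) → h v = μ • v)
    {v : V} {μ : ℝ} (hv : h v - μ • v ∈ ⨆ ν, h.eigenspace ν) : v ∈ ⨆ ν, h.eigenspace ν := by
  have key : ∀ x ∈ ⨆ ν, h.eigenspace ν, ∃ y ∈ ⨆ ν, h.eigenspace ν,
      h (x - (h y - μ • y)) = μ • (x - (h y - μ • y)) := by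
    intro x hx
    induction hx using Submodule.iSup_induction' with
    | mem ν x hx =>
      rw [mem_eigenspace_iff] at hx
      by_cases hν : ν = μ
      · exact ⟨0, zero_mem _, by simp [hx, hν]⟩
      · refine ⟨(ν - μ)⁻¹ • x, Submodule.smul_mem _ _
          (Submodule.mem_iSup_of_mem ν (mem_eigenspace_iff.mpr hx)), ?_⟩
        have : x - (h ((ν - μ)⁻¹ • x) - μ • (ν - μ)⁻¹ • x) = 0 := by
          rw [map_smul, hx, smul_comm _ ν, ← sub_smul, smul_smul,
            mul_inv_cancel₀ (sub_ne_zero.mpr hν), one_smul, sub_self]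
        rw [this, map_zero, smul_zero]
    | zero => exact ⟨0, zero_mem _, by simp⟩
    | add x x' _ _ hx hx' =>
      obtain ⟨y, hy, h1⟩ := hx
      obtain ⟨y', hy', h2⟩ := hx'
      refine ⟨y + y', add_mem hy hy', ?_⟩
      have : x + x' - (h (y + y') - μ • (y + y')) =
          (x - (h y - μ • y)) + (x' - (h y' - μ • y')) := by
        rw [map_add]; module
      rw [this, map_add, h1, h2, smul_add]
  obtain ⟨y, hy, h1⟩ := key _ hv
  have h2 : h v - μ • v - (h y - μ • y) = h (v - y) - μ • (v - y) := by
    rw [map_sub]; module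
  rw [h2] at h1
  have h3 := hss _ _ h1
  have : v = (v - y) + y := by abel
  rw [this]
  exact add_mem (Submodule.mem_iSup_of_mem μ (mem_eigenspace_iff.mpr h3)) hy

theorem mem_iSup_eigenspace_of_aeval {h : Module.End ℝ V}
    (hss : ∀ (v : V) (μ : ℝ), h (h v - μ • v) = μ • (h v - μ • v) → h v = μ • v)
    (s : Multiset ℝ) : ∀ v : V, aeval h (s.map fun a => X - C a).prod v = 0 →
      v ∈ ⨆ ν, h.eigenspace ν := by
  induction s using Multiset.induction_on with
  | empty => intro v hv; simp at hv; simp [hv]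
  | cons a s ih =>
    intro v hv
    refine mem_iSup_eigenspace_of_apply_sub hss (μ := a) (ih _ ?_)
    rw [Multiset.map_cons, Multiset.prod_cons, mul_comm, map_mul, mul_apply] at hv
    simpa using hv

theorem aeval_mul_raising (he : h * e - e * h = (2 : ℝ) • e) (s : Multiset ℝ) :
    aeval h (s.map fun a => X - C a).prod * e =
      e * aeval h ((s.map fun a => a - 2).map fun a => X - C a).prod := by
  induction s using Multiset.induction_on with
  | empty => simp
  | cons a s ih =>
    simp only [Multiset.map_cons, Multiset.prod_cons, map_mul]
    rw [mul_assoc, ih, ← mul_assoc, ← mul_assoc]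
    congr 1
    have : h * e = e * h + (2 : ℝ) • e := by rw [← he]; abel
    simp only [map_sub, aeval_X, aeval_C, sub_mul, this, mul_sub, Algebra.algebraMap_eq_smul_one,
      smul_mul_assoc, one_mul, mul_smul_comm, mul_one]
    module

/-- If `s` works for `e v`, the polynomial with roots shifted by `-2` sends `v` into `ker e`, where
the product of the factors `X - i` finishes. -/
theorem exists_multiset_of_pow_apply_eq_zero (hf : h * f - f * h = -((2 : ℝ) • f))
    (he : h * e - e * h = (2 : ℝ) • e) (hef : e * f - f * e = h) {m : ℕ} (hm : f ^ m = 0)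
    (r : ℕ) : ∀ v : V, (e ^ r) v = 0 →
      ∃ s : Multiset ℝ, aeval h (s.map fun a => X - C a).prod v = 0 := by
  induction r with
  | zero => intro v hv; exact ⟨0, by simpa using hv⟩
  | succ r ih =>
    intro v hv
    obtain ⟨s, hs⟩ := ih (e v) (by rw [← mul_apply, ← pow_succ]; exact hv)
    rw [← mul_apply, aeval_mul_raising he, mul_apply] at hs
    have h1 := aeval_apply_eq_zero_of_primitive hf he hef hm hs
    refine ⟨(Multiset.range m).map (fun i : ℕ => (i : ℝ)) + s.map (fun a => a - 2), ?_⟩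
    rw [Multiset.map_add, Multiset.prod_add, map_mul, mul_apply]
    rw [Multiset.map_map]
    exact h1

/-- In a finite-dimensional real representation of `sl₂`, the element `h` is diagonalizable. -/
theorem iSup_eigenspace_eq_top_of_bracket [FiniteDimensional ℝ V]
    (hf : h * f - f * h = -((2 : ℝ) • f))
    (he : h * e - e * h = (2 : ℝ) • e) (hef : e * f - f * e = h) :
    ⨆ μ, h.eigenspace μ = ⊤ := by
  obtain ⟨r, hr⟩ := isNilpotent_of_raising he
  obtain ⟨m, hm⟩ := isNilpotent_of_raising (h := -h) (e := f) (by
    rw [neg_mul, mul_neg, sub_neg_eq_add, neg_add_eq_sub, ← neg_inj, ← hf]; abel)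
  refine eq_top_iff.mpr fun v _ => ?_
  obtain ⟨s, hs⟩ := exists_multiset_of_pow_apply_eq_zero hf he hef hm r v (by simp [hr])
  exact mem_iSup_eigenspace_of_aeval
    (fun v μ => apply_eq_of_sub_sq_eq_zero hf he hef hm r v μ (by simp [hr])) s v hs

/-- Serves the joint decomposition of the commuting coroots, which is phrased with generalized
eigenspaces. -/
theorem maxGenEigenspace_eq_eigenspace_of_bracket [FiniteDimensional ℝ V]
    (hf : h * f - f * h = -((2 : ℝ) • f))
    (he : h * e - e * h = (2 : ℝ) • e) (hef : e * f - f * e = h) (μ : ℝ) :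
    h.maxGenEigenspace μ = h.eigenspace μ := by
  obtain ⟨r, hr⟩ := isNilpotent_of_raising he
  obtain ⟨m, hm⟩ := isNilpotent_of_raising (h := -h) (e := f) (by
    rw [neg_mul, mul_neg, sub_neg_eq_add, neg_add_eq_sub, ← neg_inj, ← hf]; abel)
  obtain ⟨g, hg⟩ : ∃ g : Module.End ℝ V, g = h - μ • 1 := ⟨_, rfl⟩
  have hss : ∀ v, g (g v) = 0 → g v = 0 := by
    intro v hv
    rw [hg] at hv ⊢
    simp only [LinearMap.sub_apply, LinearMap.smul_apply, one_apply] at hv ⊢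
    rw [sub_eq_zero] at hv ⊢
    exact apply_eq_of_sub_sq_eq_zero hf he hef hm r v μ (by rw [hr, LinearMap.zero_apply]) hv
  refine le_antisymm (fun v hv => ?_) eigenspace_le_maxGenEigenspace
  obtain ⟨k, hk⟩ := (mem_maxGenEigenspace h μ v).mp hv
  have key : ∀ k : ℕ, (g ^ k) v = 0 → g v = 0 := by
    intro k
    induction k with
    | zero => intro hk; rw [pow_zero, one_apply] at hk; rw [hk, map_zero]
    | succ k ih =>
      intro hk
      cases k with
      | zero => rwa [zero_add, pow_one] at hk
      | succ k =>
        refine ih ?_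
        rw [pow_succ', pow_succ', mul_apply, mul_apply] at hk
        rw [pow_succ', mul_apply]
        exact hss _ hk
  rw [← hg] at hk
  have := key k hk
  rw [mem_eigenspace_iff]
  rwa [hg, LinearMap.sub_apply, LinearMap.smul_apply, one_apply, sub_eq_zero] at this

end SlTwo

/-! ### Differentiability of one-parameter groups and brackets of their generators -/

section OneParameter

open MeasureTheory intervalIntegral

variable {A : Type*} [NormedRing A] [NormedAlgebra ℝ A]

/-- A continuous one-parameter group in a Banach algebra is differentiable. -/
theorem exists_generator [CompleteSpace A] {φ : ℝ → A} (hc : Continuous φ) (h0 : φ 0 = 1)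
    (hadd : ∀ s t, φ (s + t) = φ s * φ t) :
    ∃ X : A, ∀ s, HasDerivAt φ (φ s * X) s := by
  let I : ℝ → A := fun a => ∫ r in (0 : ℝ)..a, φ r
  have hI : ∀ a, HasDerivAt I (φ a) a := fun a =>
    integral_hasDerivAt_right (hc.intervalIntegrable _ _)
      hc.aestronglyMeasurable.stronglyMeasurableAtFilter hc.continuousAt
  -- The difference quotients of `I` at `0` tend to `φ 0 = 1`, and units form an open set.
  obtain ⟨a, ha⟩ : ∃ a, IsUnit (I a) := by
    have h1 : Filter.Tendsto (slope I 0) (nhdsWithin 0 {0}ᶜ) (nhds 1) := by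
      have := (hI 0).tendsto_slope
      rwa [h0] at this
    have h2 : ∀ᶠ a in nhdsWithin (0 : ℝ) {0}ᶜ, IsUnit (slope I 0 a) :=
      h1.eventually (Units.isOpen.mem_nhds isUnit_one)
    obtain ⟨a, ha, ha0⟩ := (h2.and self_mem_nhdsWithin).exists
    refine ⟨a, ?_⟩
    have ha0 : a ≠ 0 := ha0
    have hI0 : I 0 = 0 := integral_same
    rw [slope_def_module, hI0, sub_zero, sub_zero] at ha
    have : I a = (algebraMap ℝ A a) * (a⁻¹ • I a) := by
      rw [← Algebra.smul_def, smul_smul, mul_inv_cancel₀ ha0, one_smul]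
    rw [this]
    exact ((isUnit_iff_ne_zero.mpr ha0).map (algebraMap ℝ A)).mul ha
  obtain ⟨J, hJ⟩ := ha.exists_right_inv
  -- Integrating the group law gives `φ s * I a = I (s + a) - I s`; the right side is
  -- differentiable, and `I a` can be divided out.
  have hφ : ∀ s, φ s = (I (s + a) - I s) * J := by
    intro s
    have h1 : φ s * I a = I (s + a) - I s := by
      have : I (s + a) - I s = ∫ r in s..(s + a), φ r :=
        integral_interval_sub_left (hc.intervalIntegrable _ _) (hc.intervalIntegrable _ _)
      rw [this]
      have h2 := integral_comp_add_left (a := 0) (b := a) φ s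
      rw [add_zero] at h2
      rw [← h2]
      simp only [hadd, I]
      exact ((ContinuousLinearMap.mul ℝ A (φ s)).intervalIntegral_comp_comm
        (hc.intervalIntegrable _ _)).symm
    rw [← h1, mul_assoc, hJ, mul_one]
  have hd : HasDerivAt φ ((φ (0 + a) - φ 0) * J) 0 := by
    have h1 : HasDerivAt (fun s => (I (s + a) - I s) * J) ((φ (0 + a) - φ 0) * J) 0 :=
      (((hI (0 + a)).comp_add_const 0 a).sub (hI 0)).mul_const J
    exact h1.congr_of_eventuallyEq (Filter.Eventually.of_forall hφ)
  refine ⟨(φ (0 + a) - φ 0) * J, fun s => ?_⟩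
  have h1 : HasDerivAt (fun t => φ s * φ (t - s)) (φ s * ((φ (0 + a) - φ 0) * J)) s := by
    refine HasDerivAt.const_mul (φ s) ?_
    have := HasDerivAt.comp_sub_const (f := φ) (f' := (φ (0 + a) - φ 0) * J) s s (by rwa [sub_self])
    exact this
  refine h1.congr_of_eventuallyEq (Filter.Eventually.of_forall fun t => ?_)
  simp only [← hadd, add_sub_cancel]

/-- Infinitesimal form of the conjugation relation: differentiate in `s` at `0`, then in `t` at `0`.
-/
theorem bracket_of_conj {φ ψ : ℝ → A} {H E : A} {c : ℝ} (hφ0 : φ 0 = 1)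
    (hφ : HasDerivAt φ H 0) (hψ : HasDerivAt ψ E 0)
    (hrel : ∀ t s, φ t * ψ s = ψ (Real.exp (t * c) * s) * φ t) : H * E - E * H = c • E := by
  have h1 : ∀ t, φ t * E = Real.exp (t * c) • (E * φ t) := by
    intro t
    have hl : HasDerivAt (fun s => φ t * ψ s) (φ t * E) 0 := hψ.const_mul (φ t)
    have hlin : HasDerivAt (fun s : ℝ => Real.exp (t * c) * s) (Real.exp (t * c)) 0 := by
      simpa using (hasDerivAt_id (0 : ℝ)).const_mul (Real.exp (t * c))
    have hr : HasDerivAt (fun s => ψ (Real.exp (t * c) * s) * φ t)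
        ((Real.exp (t * c) • E) * φ t) 0 :=
      (HasDerivAt.scomp (0 : ℝ) (by simpa using hψ) hlin).mul_const (φ t)
    have := hl.unique (hr.congr_of_eventuallyEq (Filter.Eventually.of_forall (hrel t)))
    rw [this, smul_mul_assoc]
  have hl : HasDerivAt (fun t => φ t * E) (H * E) 0 := hφ.mul_const E
  have hexp : HasDerivAt (fun t : ℝ => Real.exp (t * c)) c 0 := by
    simpa using ((hasDerivAt_id (0 : ℝ)).mul_const c).exp
  have hr : HasDerivAt (fun t => Real.exp (t * c) • (E * φ t))
      (Real.exp (0 * c) • (E * H) + c • (E * φ 0)) 0 := hexp.smul (hφ.const_mul E)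
  have := hl.unique (hr.congr_of_eventuallyEq (Filter.Eventually.of_forall h1))
  rw [this, hφ0, zero_mul, Real.exp_zero, one_smul, mul_one]
  abel

/-- Differentiating the Gauss decomposition in `s` and then in `t` at `0` leaves only the diagonal
factor, through `log (1 + s * t) ≈ s * t`. -/
theorem bracket_of_gauss {φe φf φh : ℝ → A} {E F H : A}
    (he0 : φe 0 = 1) (hf0 : φf 0 = 1) (hh0 : φh 0 = 1)
    (he : HasDerivAt φe E 0) (hf : ∀ s, HasDerivAt φf (φf s * F) s) (hh : HasDerivAt φh H 0)
    (hrel : ∀ s t : ℝ, 0 < 1 + s * t →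
      φe s * φf t = φf (t / (1 + s * t)) * φh (Real.log (1 + s * t)) * φe (s / (1 + s * t))) :
    E * F - F * E = H := by
  have h1 : ∀ t, E * φf t = (-t ^ 2) • (φf t * F) + t • (φf t * H) + φf t * E := by
    intro t
    have hden : HasDerivAt (fun s : ℝ => 1 + s * t) t 0 := by
      simpa using ((hasDerivAt_id (0 : ℝ)).mul_const t).const_add 1
    have hne : (1 : ℝ) + 0 * t ≠ 0 := by simp
    have hl : HasDerivAt (fun s => φe s * φf t) (E * φf t) 0 := he.mul_const _
    have ha : HasDerivAt (fun s : ℝ => t / (1 + s * t)) (-t ^ 2) 0 := by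
      have : HasDerivAt (fun s : ℝ => t / (1 + s * t)) _ 0 :=
        (hasDerivAt_const (0 : ℝ) t).div hden hne
      simpa [pow_two] using this
    have hb : HasDerivAt (fun s : ℝ => Real.log (1 + s * t)) t 0 := by
      simpa using hden.log hne
    have hc : HasDerivAt (fun s : ℝ => s / (1 + s * t)) 1 0 := by
      have : HasDerivAt (fun s : ℝ => s / (1 + s * t)) _ 0 :=
        (hasDerivAt_id (0 : ℝ)).div hden hne
      simpa using this
    have hA : HasDerivAt (fun s => φf (t / (1 + s * t))) ((-t ^ 2) • (φf t * F)) 0 :=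
      HasDerivAt.scomp (0 : ℝ) (by simpa using hf t) ha
    have hB : HasDerivAt (fun s => φh (Real.log (1 + s * t))) (t • H) 0 :=
      HasDerivAt.scomp (0 : ℝ) (by simpa using hh) hb
    have hC : HasDerivAt (fun s => φe (s / (1 + s * t))) ((1 : ℝ) • E) 0 :=
      HasDerivAt.scomp (0 : ℝ) (by simpa using he) hc
    have hr := (hA.mul hB).mul hC
    have hev : ∀ᶠ s in nhds (0 : ℝ), φe s * φf t =
        φf (t / (1 + s * t)) * φh (Real.log (1 + s * t)) * φe (s / (1 + s * t)) := by
      have : ∀ᶠ s in nhds (0 : ℝ), 0 < 1 + s * t :=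
        hden.continuousAt.eventually (lt_mem_nhds (by simp))
      exact this.mono fun s hs => hrel s t hs
    have := hl.unique (hr.congr_of_eventuallyEq hev)
    simp only [zero_mul, add_zero, div_one, Real.log_one, hh0, he0, mul_one, one_smul,
      mul_smul_comm, Pi.mul_apply] at this
    exact this
  have hl : HasDerivAt (fun t => E * φf t) (E * F) 0 := by
    have := (hf 0).const_mul E
    rwa [hf0, one_mul] at this
  have hid := hasDerivAt_id (0 : ℝ)
  have hF : HasDerivAt φf F 0 := by simpa [hf0] using hf 0
  have hr := (((hid.pow 2).neg.smul (hF.mul_const F)).add (hid.smul (hF.mul_const H))).add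
    (hF.mul_const E)
  have := hl.unique (hr.congr_of_eventuallyEq (Filter.Eventually.of_forall h1))
  simp [hf0] at this
  rw [this]
  abel

end OneParameter

section OneParameterModule

variable {V : Type*} [NormedAddCommGroup V] [NormedSpace ℝ V]

/-- A vector on which a one-parameter group acts to first order by `μ` is an eigenvector. -/
theorem apply_eq_exp_smul_of_hasDerivAt {φ : ℝ → V →ₗ[ℝ] V} [FiniteDimensional ℝ V]
    (h0 : φ 0 = 1) (hadd : ∀ s t, φ (s + t) = φ s * φ t) {v : V} {μ : ℝ}
    (hv : HasDerivAt (fun s => φ s v) (μ • v) 0) (s : ℝ) : φ s v = Real.exp (s * μ) • v := by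
  have hd : ∀ t, HasDerivAt (fun s => φ s v) (μ • φ t v) t := by
    intro t
    have h1 : HasDerivAt (fun s => φ (s - t) v) (μ • v) t :=
      HasDerivAt.comp_sub_const (f := fun s => φ s v) t t (by rwa [sub_self])
    have h2 := (LinearMap.toContinuousLinearMap (φ t)).hasFDerivAt.comp_hasDerivAt t h1
    have h3 : (fun s => φ s v) =
        (fun s => (LinearMap.toContinuousLinearMap (φ t)) (φ (s - t) v)) := by
      funext s
      rw [LinearMap.coe_toContinuousLinearMap', ← Module.End.mul_apply, ← hadd, add_sub_cancel]
    rw [h3]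
    rw [map_smul] at h2
    exact h2
  have hd' : ∀ t, HasDerivAt (fun s => Real.exp (-(s * μ)) • φ s v) 0 t := by
    intro t
    have h1 : HasDerivAt (fun s => Real.exp (-(s * μ))) (Real.exp (-(t * μ)) * -(1 * μ)) t :=
      (((hasDerivAt_id t).mul_const μ).neg).exp
    have h2 := h1.smul (hd t)
    have h3 : Real.exp (-(t * μ)) • μ • φ t v + (Real.exp (-(t * μ)) * -(1 * μ)) • φ t v = 0 := by
      module
    rw [h3] at h2
    exact h2
  have hconst := is_const_of_deriv_eq_zero (fun t => (hd' t).differentiableAt)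
    (fun t => (hd' t).deriv) s 0
  simp only [zero_mul, neg_zero, Real.exp_zero, one_smul, h0, Module.End.one_apply] at hconst
  conv_rhs => rw [← hconst]
  rw [smul_smul, ← Real.exp_add, add_neg_cancel, Real.exp_zero, one_smul]

theorem hasDerivAt_of_apply_eq_exp_smul {φ : ℝ → V →ₗ[ℝ] V} {v : V} {μ : ℝ}
    (hv : ∀ s, φ s v = Real.exp (s * μ) • v) : HasDerivAt (fun s => φ s v) (μ • v) 0 := by
  simp only [hv]
  have h1 : HasDerivAt (fun s => Real.exp (s * μ)) (Real.exp (0 * μ) * (1 * μ)) 0 :=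
    ((hasDerivAt_id (0 : ℝ)).mul_const μ).exp
  simpa using h1.smul_const v

end OneParameterModule

/-! ### The diagonal torus and the `SL₂` subgroups attached to its coroots -/

section Torus

open Matrix

variable {d : ℕ}

theorem eq_of_coe_eq {n : ℕ} {g g' : SL(n, ℝ)}
    (h : (g : Matrix (Fin n) (Fin n) ℝ) = (g' : Matrix (Fin n) (Fin n) ℝ)) : g = g' :=
  Subtype.ext h

/-- The diagonal matrix with entries `exp y_i`, normalized to have determinant `1`. -/
noncomputable def diagSL (y : Fin (d + 1) → ℝ) : SL(d + 1, ℝ) :=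
  ⟨diagonal fun i => Real.exp (y i - (∑ j, y j) / (d + 1 : ℕ)), by
    rw [det_diagonal, ← Real.exp_sum, Real.exp_eq_one_iff, Finset.sum_sub_distrib,
      Finset.sum_const, Finset.card_univ, Fintype.card_fin, nsmul_eq_mul,
      mul_div_cancel₀ _ (by positivity), sub_self]⟩

theorem coe_diagSL (y : Fin (d + 1) → ℝ) :
    (diagSL y : Matrix (Fin (d + 1)) (Fin (d + 1)) ℝ) =
      diagonal fun i => Real.exp (y i - (∑ j, y j) / (d + 1 : ℕ)) := rfl

theorem coe_diagSL_of_sum_eq_zero {y : Fin (d + 1) → ℝ} (hy : ∑ i, y i = 0) :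
    (diagSL y : Matrix (Fin (d + 1)) (Fin (d + 1)) ℝ) = diagonal fun i => Real.exp (y i) := by
  simp [coe_diagSL, hy]

theorem diagSL_add (y z : Fin (d + 1) → ℝ) : diagSL (y + z) = diagSL y * diagSL z := by
  refine eq_of_coe_eq ?_
  rw [Matrix.SpecialLinearGroup.coe_mul, coe_diagSL, coe_diagSL, coe_diagSL, diagonal_mul_diagonal]
  congr 1
  funext i
  rw [← Real.exp_add, Pi.add_apply]
  congr 1
  simp only [Pi.add_apply, Finset.sum_add_distrib]
  ring

@[simp]
theorem diagSL_zero : diagSL (0 : Fin (d + 1) → ℝ) = 1 := by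
  refine eq_of_coe_eq ?_
  simp [coe_diagSL]

theorem continuous_diagSL : Continuous (diagSL : (Fin (d + 1) → ℝ) → SL(d + 1, ℝ)) := by
  refine Continuous.subtype_mk ?_ _
  refine Continuous.matrix_diagonal ?_
  fun_prop

theorem diagSL_mul_mul_apply (y z : Fin (d + 1) → ℝ) (hyz : ∑ i, y i = ∑ i, z i)
    (g : SL(d + 1, ℝ)) (i j : Fin (d + 1)) :
    (diagSL y * g * diagSL (-z)) i j = Real.exp (y i - z j) * g i j := by
  have h : ((diagSL y * g * diagSL (-z) : SL(d + 1, ℝ)) : Matrix (Fin (d + 1)) (Fin (d + 1)) ℝ) =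
    (diagSL y : Matrix (Fin (d + 1)) (Fin (d + 1)) ℝ) * (g : Matrix (Fin (d + 1)) (Fin (d + 1)) ℝ) *
      (diagSL (-z) : Matrix (Fin (d + 1)) (Fin (d + 1)) ℝ) := by
    rw [Matrix.SpecialLinearGroup.coe_mul, Matrix.SpecialLinearGroup.coe_mul]
  refine (congrFun (congrFun h i) j).trans ?_
  rw [coe_diagSL, coe_diagSL,
    mul_diagonal, diagonal_mul]
  rw [mul_right_comm, ← Real.exp_add]
  congr 2
  simp only [Pi.neg_apply, Finset.sum_neg_distrib, hyz]
  ring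

theorem diagonal_mul_single_eq (v : Fin (d + 1) → ℝ) (i j : Fin (d + 1)) (a : ℝ) :
    diagonal v * single i j a = single i j (v i * a) := by
  ext k l
  rw [diagonal_mul, single_apply, single_apply]
  split_ifs with h
  · rw [h.1]
  · rw [mul_zero]

theorem single_mul_diagonal_eq (v : Fin (d + 1) → ℝ) (i j : Fin (d + 1)) (a : ℝ) :
    single i j a * diagonal v = single i j (a * v j) := by
  ext k l
  rw [mul_diagonal, single_apply, single_apply]
  split_ifs with h
  · rw [h.2]
  · rw [zero_mul]

/-- The coroot of the pair of indices `(0, r + 1)`. -/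
def coroot (r : Fin d) : Fin (d + 1) → ℝ := Pi.single 0 1 - Pi.single r.succ 1

theorem sum_coroot (r : Fin d) : ∑ i, coroot r i = 0 := by
  simp [coroot, Finset.sum_sub_distrib]

theorem sum_smul_coroot (s : ℝ) (r : Fin d) : ∑ i, (s • coroot r) i = 0 := by
  simp [← Finset.mul_sum, sum_coroot]

theorem diagSL_mul_upper (r : Fin d) (t s : ℝ) :
    diagSL (t • coroot r) * Matrix.SpecialLinearGroup.transvection (Fin.succ_ne_zero r).symm s =
      Matrix.SpecialLinearGroup.transvection (Fin.succ_ne_zero r).symm (Real.exp (t * 2) * s) *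
        diagSL (t • coroot r) := by
  refine eq_of_coe_eq ?_
  rw [Matrix.SpecialLinearGroup.coe_mul, Matrix.SpecialLinearGroup.coe_mul,
    coe_diagSL_of_sum_eq_zero (sum_smul_coroot t r), Matrix.SpecialLinearGroup.transvection_coe,
    Matrix.SpecialLinearGroup.transvection_coe, mul_add, add_mul, mul_one, one_mul, diagonal_mul_single_eq,
    single_mul_diagonal_eq]
  congr 2
  simp only [coroot, Pi.smul_apply, Pi.sub_apply, Pi.single_eq_same, smul_eq_mul,
    Pi.single_eq_of_ne (Fin.succ_ne_zero r), Pi.single_eq_of_ne (Fin.succ_ne_zero r).symm]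
  rw [mul_right_comm, ← Real.exp_add]
  congr 2
  ring

theorem diagSL_mul_lower (r : Fin d) (t s : ℝ) :
    diagSL (t • coroot r) * Matrix.SpecialLinearGroup.transvection (Fin.succ_ne_zero r) s =
      Matrix.SpecialLinearGroup.transvection (Fin.succ_ne_zero r) (Real.exp (t * (-2)) * s) *
        diagSL (t • coroot r) := by
  refine eq_of_coe_eq ?_
  rw [Matrix.SpecialLinearGroup.coe_mul, Matrix.SpecialLinearGroup.coe_mul,
    coe_diagSL_of_sum_eq_zero (sum_smul_coroot t r), Matrix.SpecialLinearGroup.transvection_coe,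
    Matrix.SpecialLinearGroup.transvection_coe, mul_add, add_mul, mul_one, one_mul, diagonal_mul_single_eq,
    single_mul_diagonal_eq]
  congr 2
  simp only [coroot, Pi.smul_apply, Pi.sub_apply, Pi.single_eq_same, smul_eq_mul,
    Pi.single_eq_of_ne (Fin.succ_ne_zero r), Pi.single_eq_of_ne (Fin.succ_ne_zero r).symm]
  rw [mul_right_comm, ← Real.exp_add]
  congr 2
  ring

theorem diagonal_exp_log_smul_coroot (r : Fin d) {c : ℝ} (hc : 0 < c) :
    (diagonal fun i => Real.exp ((Real.log c • coroot r) i) : Matrix _ _ ℝ) =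
      1 + single 0 0 (c - 1) + single r.succ r.succ (c⁻¹ - 1) := by
  rw [← diagonal_one, ← diagonal_single, ← diagonal_single, diagonal_add, diagonal_add]
  congr 1
  funext i
  rcases Fin.eq_zero_or_eq_succ i with rfl | ⟨j, rfl⟩
  · simp [coroot, Real.exp_log hc]
  · rcases eq_or_ne j r with rfl | hj
    · simp [coroot, Real.exp_neg, Real.exp_log hc]
    · simp [coroot, hj]

/-- The Gauss decomposition of a product of an upper and a lower elementary matrix. -/
theorem upper_mul_lower (r : Fin d) (s t : ℝ) (hst : 0 < 1 + s * t) :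
    Matrix.SpecialLinearGroup.transvection (Fin.succ_ne_zero r).symm s *
        Matrix.SpecialLinearGroup.transvection (Fin.succ_ne_zero r) t =
      Matrix.SpecialLinearGroup.transvection (Fin.succ_ne_zero r) (t / (1 + s * t)) *
        diagSL (Real.log (1 + s * t) • coroot r) *
        Matrix.SpecialLinearGroup.transvection (Fin.succ_ne_zero r).symm (s / (1 + s * t)) := by
  refine eq_of_coe_eq ?_
  simp only [Matrix.SpecialLinearGroup.coe_mul, coe_diagSL_of_sum_eq_zero (sum_smul_coroot _ r),
    Matrix.SpecialLinearGroup.transvection_coe, diagonal_exp_log_smul_coroot r hst]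
  set c := 1 + s * t with hc
  have h0 := Fin.succ_ne_zero r
  simp only [mul_add, add_mul, one_mul, mul_one, single_mul_single_same,
    single_mul_single_of_ne _ _ _ _ h0, single_mul_single_of_ne _ _ _ _ h0.symm, add_zero]
  have e1 : t / c * (c - 1) + t / c = t := by field_simp; ring
  have e2 : (c - 1) * (s / c) + s / c = s := by field_simp; ring
  have e4 : c - 1 = s * t := by rw [hc]; ring
  have e3 : t / c * (s / c) + t / c * (c - 1) * (s / c) + (c⁻¹ - 1) = 0 := by
    have : t / c * (s / c) + t / c * (c - 1) * (s / c) = (s * t) * c / (c * c) := by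
      field_simp; ring
    rw [this, ← e4]; field_simp; ring
  have f1 := congrArg (single r.succ (0 : Fin (d + 1))) e1
  have f2 := congrArg (single (0 : Fin (d + 1)) r.succ) e2
  have f3 := congrArg (single r.succ r.succ) e3
  rw [single_add] at f1 f2
  rw [single_add, single_add, single_zero] at f3
  rw [e4] at f1 f2 f3 ⊢
  rw [← f1]
  conv_lhs => rw [← f2]
  rw [← add_zero (_ + _ : Matrix _ _ ℝ), ← f3]
  abel

end Torus

/-! ### Weight decomposition under the torus -/

section Components

/-- A subspace invariant under operators acting by distinct characters on the summands of one of
its elements contains each of the summands. -/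
theorem mem_of_sum_mem {V Y ι : Type*} [AddCommGroup V] [Module ℝ V] (F : Y → V →ₗ[ℝ] V)
    (Z : Submodule ℝ V) (hZ : ∀ y, ∀ z ∈ Z, F y z ∈ Z) (χ : ι → Y → ℝ)
    (hχ : Function.Injective χ) (S : Finset ι) :
    ∀ v : ι → V, (∀ i ∈ S, ∀ y, F y (v i) = χ i y • v i) → ∑ i ∈ S, v i ∈ Z →
      ∀ i ∈ S, v i ∈ Z := by
  classical
  induction S using Finset.induction_on with
  | empty => simp
  | insert a S ha ih =>
    intro v hv hs
    have hS : ∀ i ∈ S, v i ∈ Z := by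
      intro i hi
      have hne : i ≠ a := fun h => ha (h ▸ hi)
      obtain ⟨y, hy⟩ : ∃ y, χ i y ≠ χ a y := by
        by_contra! h
        exact hne (hχ (funext h))
      have h1 : ∑ j ∈ S, (χ j y - χ a y) • v j ∈ Z := by
        -- The operator `F y - χ a y` removes the summand `a` and multiplies the summand `i` by a
        -- nonzero scalar, so induction applies to the rest.
        have h2 : F y (∑ j ∈ insert a S, v j) - χ a y • ∑ j ∈ insert a S, v j ∈ Z :=
          Z.sub_mem (hZ y _ hs) (Z.smul_mem _ hs)
        rw [map_sum, Finset.smul_sum, ← Finset.sum_sub_distrib, Finset.sum_insert ha,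
          hv a (Finset.mem_insert_self a S), sub_self, zero_add] at h2
        have h3 : ∑ j ∈ S, (χ j y - χ a y) • v j = ∑ j ∈ S, (F y (v j) - χ a y • v j) :=
          Finset.sum_congr rfl fun j hj => by
            rw [hv j (Finset.mem_insert_of_mem hj), sub_smul]
        rwa [h3]
      have h3 := ih (fun j => (χ j y - χ a y) • v j) (fun j hj z => by
        rw [map_smul, hv j (Finset.mem_insert_of_mem hj), smul_comm]) h1 i hi
      exact (Z.smul_mem_iff (sub_ne_zero.mpr hy)).mp h3
    intro i hi
    rcases Finset.mem_insert.mp hi with rfl | hi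
    · rw [Finset.sum_insert ha] at hs
      exact (Z.add_mem_iff_left (Z.sum_mem hS)).mp hs
    · exact hS i hi

end Components

section Weights

open Matrix

variable {d k : ℕ} {V : Type*} [NormedAddCommGroup V] [NormedSpace ℝ V]
  (ρ : Representation ℝ SL(d + 1, ℝ) V)

/-- The weight spaces of the diagonal torus. -/
def torusWeight (x : Fin (d + 1) → ℝ) : Submodule ℝ V where
  carrier := {v | ∀ y, ρ (diagSL y) v = Real.exp (x ⬝ᵥ y) • v}
  add_mem' ha hb y := by rw [map_add, ha, hb, smul_add]
  zero_mem' y := by simp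
  smul_mem' c v hv y := by rw [map_smul, hv, smul_comm]

variable {ρ}

theorem apply_diagSL_of_mem {x : Fin (d + 1) → ℝ} {v : V} (hv : v ∈ torusWeight ρ x)
    (y : Fin (d + 1) → ℝ) : ρ (diagSL y) v = Real.exp (x ⬝ᵥ y) • v := hv y

theorem exp_dotProduct_injective :
    Function.Injective fun (x y : Fin (d + 1) → ℝ) => Real.exp (x ⬝ᵥ y) := by
  intro x x' h
  funext i
  have := congrFun h (Pi.single i 1)
  simpa using this

theorem continuous_toContinuousLinearMap [FiniteDimensional ℝ V]
    (hρ : ∀ v : V, Continuous fun g => ρ g v) :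
    Continuous fun g => LinearMap.toContinuousLinearMap (ρ g) :=
  continuous_clm_apply.mpr hρ

theorem toContinuousLinearMap_mul [FiniteDimensional ℝ V] (g g' : SL(d + 1, ℝ)) :
    LinearMap.toContinuousLinearMap (ρ (g * g')) =
      LinearMap.toContinuousLinearMap (ρ g) * LinearMap.toContinuousLinearMap (ρ g') := by
  ext v
  simp

theorem toContinuousLinearMap_one [FiniteDimensional ℝ V] :
    LinearMap.toContinuousLinearMap (ρ 1) = 1 := by
  ext v
  simp

theorem continuous_transvection {i j : Fin (d + 1)} (hij : i ≠ j) :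
    Continuous (Matrix.SpecialLinearGroup.transvection (F := ℝ) hij) := by
  refine Continuous.subtype_mk ?_ _
  unfold Matrix.transvection
  refine continuous_const.add ?_
  refine continuous_matrix fun k l => ?_
  simp only [single_apply]
  split_ifs <;> fun_prop

/-- The coroots act diagonalizably, with commuting generators. -/
theorem exists_coroot_generator [FiniteDimensional ℝ V]
    (hρ : ∀ v : V, Continuous fun g => ρ g v) :
    ∃ X : Fin d → V →L[ℝ] V,
      (∀ r, ∀ s, HasDerivAt (fun t : ℝ => LinearMap.toContinuousLinearMap (ρ (diagSL (t • coroot r))))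
        (LinearMap.toContinuousLinearMap (ρ (diagSL (s • coroot r))) * X r) s) ∧
      (∀ r q, X r * X q = X q * X r) ∧
      (∀ r, ⨆ μ, Module.End.eigenspace (X r : V →ₗ[ℝ] V) μ = ⊤) ∧
      (∀ r μ, Module.End.maxGenEigenspace (X r : V →ₗ[ℝ] V) μ =
        Module.End.eigenspace (X r : V →ₗ[ℝ] V) μ) := by
  have : CompleteSpace V := FiniteDimensional.complete ℝ V
  let Φ : SL(d + 1, ℝ) → V →L[ℝ] V := fun g => LinearMap.toContinuousLinearMap (ρ g)
  have hΦ : Continuous Φ := continuous_toContinuousLinearMap hρ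
  have hmul : ∀ g g', Φ (g * g') = Φ g * Φ g' := toContinuousLinearMap_mul
  have hone : Φ 1 = 1 := toContinuousLinearMap_one
  have h0 : ∀ r, Φ (diagSL ((0 : ℝ) • coroot r)) = 1 := fun r => by
    rw [zero_smul, diagSL_zero, hone]
  have hH : ∀ r : Fin d, ∃ X : V →L[ℝ] V, ∀ s, HasDerivAt (fun t : ℝ => Φ (diagSL (t • coroot r)))
      (Φ (diagSL (s • coroot r)) * X) s := fun r =>
    exists_generator (hΦ.comp (continuous_diagSL.comp (by fun_prop))) (h0 r)
      fun s t => by rw [add_smul, diagSL_add, hmul]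
  have hT : ∀ {i j : Fin (d + 1)} (hij : i ≠ j), ∃ X : V →L[ℝ] V, ∀ s,
      HasDerivAt (fun t : ℝ => Φ (Matrix.SpecialLinearGroup.transvection hij t))
        (Φ (Matrix.SpecialLinearGroup.transvection hij s) * X) s := fun hij =>
    exists_generator (hΦ.comp (continuous_transvection hij)) (by
      rw [Matrix.SpecialLinearGroup.transvection_coeff_zero, hone])
      fun s t => by rw [Matrix.SpecialLinearGroup.transvection_add, hmul]
  have hT0 : ∀ {i j : Fin (d + 1)} (hij : i ≠ j),
      Φ (Matrix.SpecialLinearGroup.transvection hij 0) = 1 := fun hij => by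
    rw [Matrix.SpecialLinearGroup.transvection_coeff_zero, hone]
  choose X hX using hH
  have hX0 : ∀ r, HasDerivAt (fun t : ℝ => Φ (diagSL (t • coroot r))) (X r) 0 := fun r => by
    have := hX r 0
    rwa [h0, one_mul] at this
  have hbr : ∀ r : Fin d, ∃ E F : V →L[ℝ] V, X r * F - F * X r = -((2 : ℝ) • F) ∧
      X r * E - E * X r = (2 : ℝ) • E ∧ E * F - F * E = X r := by
    intro r
    obtain ⟨E, hE⟩ := hT (Fin.succ_ne_zero r).symm
    obtain ⟨F, hF⟩ := hT (Fin.succ_ne_zero r)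
    have hE0 := hE 0
    have hF0 := hF 0
    rw [hT0, one_mul] at hE0 hF0
    refine ⟨E, F, ?_, ?_, ?_⟩
    · rw [← neg_smul]
      exact bracket_of_conj (h0 r) (hX0 r) hF0 fun t s => by
        rw [← hmul, ← hmul, diagSL_mul_lower]
    · exact bracket_of_conj (h0 r) (hX0 r) hE0 fun t s => by
        rw [← hmul, ← hmul, diagSL_mul_upper]
    · exact bracket_of_gauss (hT0 _) (hT0 _) (h0 r) hE0 hF (hX0 r) fun s t hst => by
        rw [← hmul, ← hmul, ← hmul, upper_mul_lower r s t hst]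
  refine ⟨X, hX, fun r q => ?_, fun r => ?_, fun r μ => ?_⟩
  -- Commuting groups are the case `c = 0` of the conjugation relation.
  · have := bracket_of_conj (c := 0) (h0 r) (hX0 r) (hX0 q) fun t s => by
      rw [← hmul, ← hmul, ← diagSL_add, add_comm, diagSL_add]
      simp
    rwa [zero_smul, sub_eq_zero] at this
  · obtain ⟨E, F, h1, h2, h3⟩ := hbr r
    exact iSup_eigenspace_eq_top_of_bracket (e := (E : V →ₗ[ℝ] V)) (f := (F : V →ₗ[ℝ] V))
      (congrArg ContinuousLinearMap.toLinearMap h1) (congrArg ContinuousLinearMap.toLinearMap h2)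
      (congrArg ContinuousLinearMap.toLinearMap h3)
  · obtain ⟨E, F, h1, h2, h3⟩ := hbr r
    exact maxGenEigenspace_eq_eigenspace_of_bracket (e := (E : V →ₗ[ℝ] V)) (f := (F : V →ₗ[ℝ] V))
      (congrArg ContinuousLinearMap.toLinearMap h1) (congrArg ContinuousLinearMap.toLinearMap h2)
      (congrArg ContinuousLinearMap.toLinearMap h3) μ

theorem diagSL_sub_mean (y : Fin (d + 1) → ℝ) :
    diagSL (y - fun _ => (∑ j, y j) / (d + 1 : ℕ)) = diagSL y := by
  refine eq_of_coe_eq ?_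
  rw [coe_diagSL, coe_diagSL]
  congr 1
  funext i
  congr 1
  simp only [Pi.sub_apply, Finset.sum_sub_distrib, Finset.sum_const, Finset.card_univ,
    Fintype.card_fin, nsmul_eq_mul]
  rw [mul_div_cancel₀ _ (by positivity), sub_self, zero_div, sub_zero]

theorem eq_sum_coroot {y : Fin (d + 1) → ℝ} (hy : ∑ i, y i = 0) :
    y = ∑ r, (-y (Fin.succ r)) • coroot r := by
  funext i
  rw [Finset.sum_apply]
  rcases Fin.eq_zero_or_eq_succ i with rfl | ⟨j, rfl⟩
  · rw [Fin.sum_univ_succ] at hy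
    simp [coroot]
    linarith
  · simp [coroot, Pi.single_apply]

/-- The representation space is spanned by weight vectors of the diagonal torus. -/
theorem iSup_torusWeight_eq_top [FiniteDimensional ℝ V]
    (hρ : ∀ v : V, Continuous fun g => ρ g v) : ⨆ x, torusWeight ρ x = ⊤ := by
  obtain ⟨X, hX, hcomm, htop, hss⟩ := exists_coroot_generator hρ
  have hjoint := Module.End.iSup_iInf_maxGenEigenspace_eq_top_of_iSup_maxGenEigenspace_eq_top_of_commute
    (fun r => (X r : V →ₗ[ℝ] V))
    (fun r q _ => congrArg ContinuousLinearMap.toLinearMap (hcomm r q))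
    (fun r => by simpa only [hss] using htop r)
  refine eq_top_iff.mpr (hjoint.symm.le.trans (iSup_le fun χ => ?_))
  -- The vector `(0, -χ)` pairs with coroot `r` to `χ r`. The added constant makes the coordinates
  -- sum to zero, as it must because `diagSL` ignores constant shifts of its argument.
  have hle : ⨅ r, Module.End.maxGenEigenspace (X r : V →ₗ[ℝ] V) (χ r) ≤
      torusWeight ρ (fun i => Fin.cons (α := fun _ => ℝ) 0 (-χ) i + (∑ r, χ r) / (d + 1 : ℕ)) := by
    intro v hv
    simp only [hss, Submodule.mem_iInf, Module.End.mem_eigenspace_iff] at hv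
    have h1 : ∀ r s, ρ (diagSL (s • coroot r)) v = Real.exp (s * χ r) • v := by
      intro r s
      refine apply_eq_exp_smul_of_hasDerivAt (φ := fun s => ρ (diagSL (s • coroot r)))
        (by simp) (fun s t => by rw [add_smul, diagSL_add, map_mul]) ?_ s
      have h2 := (hX r 0).clm_apply (hasDerivAt_const (0 : ℝ) v)
      have h3 : X r v = χ r • v := hv r
      simpa [h3] using h2
    have h2 : ∀ (c : Fin d → ℝ) (S : Finset (Fin d)),
        ρ (diagSL (∑ r ∈ S, c r • coroot r)) v = Real.exp (∑ r ∈ S, c r * χ r) • v := by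
      classical
      intro c S
      induction S using Finset.induction_on with
      | empty => simp
      | insert a S ha ih =>
        rw [Finset.sum_insert ha, Finset.sum_insert ha, diagSL_add, map_mul, Module.End.mul_apply,
          ih, map_smul, h1, smul_smul, ← Real.exp_add, add_comm]
    intro y
    set c := (∑ j, y j) / (d + 1 : ℕ) with hc
    have hy : ∑ i, (y - fun _ : Fin (d + 1) => c) i = 0 := by
      simp only [Pi.sub_apply, Finset.sum_sub_distrib, Finset.sum_const, Finset.card_univ,
        Fintype.card_fin, nsmul_eq_mul]
      rw [hc, mul_div_cancel₀ _ (by positivity), sub_self]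
    rw [← diagSL_sub_mean, ← hc, eq_sum_coroot hy, h2]
    congr 2
    simp only [dotProduct, add_mul, Finset.sum_add_distrib, ← Finset.mul_sum]
    rw [Fin.sum_univ_succ]
    simp only [Fin.cons_zero, Fin.cons_succ, Pi.neg_apply, Pi.sub_apply, neg_sub, sub_mul, zero_mul,
      zero_add, Finset.sum_sub_distrib, ← Finset.mul_sum, neg_mul, Finset.sum_neg_distrib]
    rw [hc]
    simp only [mul_comm (χ _)]
    ring
  exact hle.trans (le_iSup (torusWeight ρ) _)

end Weights

/-! ### Layers in terms of coroots, their weight spaces and bounded trajectories -/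

section Layers

open Matrix

variable {d k : ℕ}

/-- The coefficient of the coroot `r` in `𝒜(t)`. -/
def layerCoeff (m : Fin k → Fin (d + 1)) (t : Fin k → ℝ) (r : Fin d) : ℝ :=
  ∑ l, if r.succ ≤ m l then t l else 0

/-- The diagonal entries of `𝒜(t)`. -/
def layerExp (m : Fin k → Fin (d + 1)) (t : Fin k → ℝ) : Fin (d + 1) → ℝ :=
  Fin.cons (∑ r, layerCoeff m t r) fun r => -layerCoeff m t r

theorem layerExp_zero (m : Fin k → Fin (d + 1)) (t : Fin k → ℝ) :
    layerExp m t 0 = ∑ r, layerCoeff m t r := rfl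

theorem layerExp_succ (m : Fin k → Fin (d + 1)) (t : Fin k → ℝ) (r : Fin d) :
    layerExp m t r.succ = -layerCoeff m t r := rfl

theorem sum_layerExp (m : Fin k → Fin (d + 1)) (t : Fin k → ℝ) : ∑ i, layerExp m t i = 0 := by
  rw [Fin.sum_univ_succ, layerExp_zero]
  simp [layerExp_succ]

theorem layerCoeff_add (m : Fin k → Fin (d + 1)) (s t : Fin k → ℝ) (r : Fin d) :
    layerCoeff m (s + t) r = layerCoeff m s r + layerCoeff m t r := by
  simp only [layerCoeff, ← Finset.sum_add_distrib]
  refine Finset.sum_congr rfl fun l _ => ?_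
  split_ifs <;> simp

theorem layerExp_add (m : Fin k → Fin (d + 1)) (s t : Fin k → ℝ) :
    layerExp m (s + t) = layerExp m s + layerExp m t := by
  funext i
  rcases Fin.eq_zero_or_eq_succ i with rfl | ⟨j, rfl⟩
  · simp [layerExp_zero, layerCoeff_add, Finset.sum_add_distrib]
  · simp [layerExp_succ, layerCoeff_add, add_comm]

theorem layerMatrix_eq (p : Fin (d + 1)) :
    layerMatrix p = diagonal (Fin.cons (p : ℝ) fun r => if r.succ ≤ p then -1 else 0) := by
  ext a b
  simp only [layerMatrix, Matrix.sub_apply, Matrix.smul_apply, Matrix.sum_apply,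
    Matrix.diagonal_apply, Matrix.single_apply]
  by_cases h : a = b
  · subst h
    rcases Fin.eq_zero_or_eq_succ a with rfl | ⟨j, rfl⟩
    · simp [Finset.sum_ite_eq']
    · simp [Finset.sum_ite_eq', (Fin.succ_ne_zero j).symm]
      split_ifs <;> simp
  · have : ∀ j : Fin (d + 1), ¬ (j = a ∧ j = b) := fun j hj => h (hj.1.symm.trans hj.2)
    simp [h, this]

theorem layerSum_eq (m : Fin k → Fin (d + 1)) (t : Fin k → ℝ) :
    layerSum m t = diagonal (layerExp m t) := by
  have h : layerSum m t = diagonal (∑ l, t l •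
      (Fin.cons ((m l : ℕ) : ℝ) fun r => if r.succ ≤ m l then -1 else 0 : Fin (d + 1) → ℝ)) := by
    rw [layerSum, ← diagonalAddMonoidHom_apply, map_sum]
    exact Finset.sum_congr rfl fun l _ => by simp [layerMatrix_eq, diagonal_smul]
  rw [h]
  congr 1
  funext i
  rw [Finset.sum_apply]
  rcases Fin.eq_zero_or_eq_succ i with rfl | ⟨j, rfl⟩
  · simp only [layerExp_zero, layerCoeff]
    rw [Finset.sum_comm]
    refine Finset.sum_congr rfl fun l _ => ?_
    rw [← Finset.sum_filter, Finset.sum_const, nsmul_eq_mul, Pi.smul_apply, Fin.cons_zero,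
      smul_eq_mul, mul_comm]
    congr 2
    have h1 : ∀ r : Fin d, r.succ ≤ m l ↔ (r : ℕ) < (m l : ℕ) := fun r => by
      rw [Fin.le_def, Fin.val_succ, Nat.succ_le_iff]
    simp only [h1]
    rw [Fin.card_filter_val_lt]
    exact (min_eq_right (Nat.lt_succ_iff.mp (m l).2)).symm
  · rw [layerExp_succ, layerCoeff, ← Finset.sum_neg_distrib]
    refine Finset.sum_congr rfl fun l _ => ?_
    rw [Pi.smul_apply, Fin.cons_succ]
    split_ifs <;> simp

theorem expLayer_eq (m : Fin k → Fin (d + 1)) (t : Fin k → ℝ) :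
    expLayer m t = diagSL (layerExp m t) := by
  refine eq_of_coe_eq ?_
  rw [coe_diagSL_of_sum_eq_zero (sum_layerExp m t)]
  change NormedSpace.exp (layerSum m t) = _
  rw [layerSum_eq, exp_diagonal]
  congr 1
  funext i
  rw [Pi.coe_exp, Real.exp_eq_exp_ℝ]

theorem expLayer_add (m : Fin k → Fin (d + 1)) (s t : Fin k → ℝ) :
    expLayer m (s + t) = expLayer m s * expLayer m t := by
  simp only [expLayer_eq, layerExp_add, diagSL_add]

theorem expLayer_zero (m : Fin k → Fin (d + 1)) : expLayer m 0 = 1 := by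
  have := expLayer_add m 0 0
  rwa [add_zero, left_eq_mul] at this

theorem expLayer_neg_mul (m : Fin k → Fin (d + 1)) (t : Fin k → ℝ) :
    expLayer m (-t) * expLayer m t = 1 := by
  rw [← expLayer_add, neg_add_cancel, expLayer_zero]

theorem dotProduct_layerExp (x : Fin (d + 1) → ℝ) (m : Fin k → Fin (d + 1)) (t : Fin k → ℝ) :
    x ⬝ᵥ layerExp m t = ∑ r, layerCoeff m t r * (x 0 - x r.succ) := by
  rw [dotProduct, Fin.sum_univ_succ, layerExp_zero, Finset.mul_sum, ← Finset.sum_add_distrib]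
  refine Finset.sum_congr rfl fun r _ => ?_
  rw [layerExp_succ]
  ring

variable {V : Type*} [NormedAddCommGroup V] [NormedSpace ℝ V]
  {ρ : Representation ℝ SL(d + 1, ℝ) V}

/-- The vectors with bounded trajectory. -/
def boundedSubmodule (ρ : Representation ℝ SL(d + 1, ℝ) V) (m : Fin k → Fin (d + 1))
    (T : ℕ → Fin k → ℝ) : Submodule ℝ V where
  carrier := {v | ∃ C, ∀ i, ‖ρ (expLayer m (T i)) v‖ ≤ C}
  add_mem' := by
    rintro a b ⟨C, hC⟩ ⟨C', hC'⟩
    exact ⟨C + C', fun i => by rw [map_add]; exact norm_add_le_of_le (hC i) (hC' i)⟩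
  zero_mem' := ⟨0, by simp⟩
  smul_mem' := by
    rintro c v ⟨C, hC⟩
    exact ⟨‖c‖ * C, fun i => by
      rw [map_smul, norm_smul]; exact mul_le_mul_of_nonneg_left (hC i) (norm_nonneg c)⟩

theorem mem_boundedSubmodule_of_tendsto {m : Fin k → Fin (d + 1)} {T : ℕ → Fin k → ℝ} {v x : V}
    (h : Filter.Tendsto (fun i => ρ (expLayer m (T i)) v) Filter.atTop (nhds x)) :
    v ∈ boundedSubmodule ρ m T := by
  obtain ⟨C, hC⟩ := h.norm.bddAbove_range
  exact ⟨C, fun i => hC ⟨i, rfl⟩⟩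

theorem Vzero_sup_Vminus_le (m : Fin k → Fin (d + 1)) (T : ℕ → Fin k → ℝ) :
    Vzero ρ m T ⊔ Vminus ρ m T ≤ boundedSubmodule ρ m T :=
  sup_le (fun _ ⟨⟨_, hx⟩, _⟩ => mem_boundedSubmodule_of_tendsto hx)
    fun _ hv => mem_boundedSubmodule_of_tendsto hv

variable [FiniteDimensional ℝ V]

theorem mem_weightSpace_iff {m : Fin k → Fin (d + 1)} {μ : Fin k → ℝ} {v : V} :
    v ∈ weightSpace ρ m μ ↔ ∀ t, ρ (expLayer m t) v = Real.exp (∑ l, t l * μ l) • v := by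
  classical
  constructor
  · intro hv t
    have h1 : ∀ l s, ρ (expLayer m (Pi.single l s)) v = Real.exp (s * μ l) • v := fun l s =>
      apply_eq_exp_smul_of_hasDerivAt (φ := fun s => ρ (expLayer m (Pi.single l s)))
        (by simp [expLayer_zero]) (fun s t => by rw [Pi.single_add, expLayer_add, map_mul]) (hv l) s
    have h2 : ∀ S : Finset (Fin k), ρ (expLayer m (∑ l ∈ S, Pi.single l (t l))) v =
        Real.exp (∑ l ∈ S, t l * μ l) • v := by
      intro S
      induction S using Finset.induction_on with
      | empty => simp [expLayer_zero]
      | insert a S ha ih =>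
        rw [Finset.sum_insert ha, Finset.sum_insert ha, expLayer_add, map_mul,
          Module.End.mul_apply, ih, map_smul, h1, smul_smul, ← Real.exp_add, add_comm]
    have h3 := h2 Finset.univ
    rwa [Finset.univ_sum_single] at h3
  · intro h l
    refine hasDerivAt_of_apply_eq_exp_smul fun s => ?_
    rw [h]
    simp [Pi.single_apply]

theorem torusWeight_le_weightSpace (m : Fin k → Fin (d + 1)) (x : Fin (d + 1) → ℝ) :
    torusWeight ρ x ≤
      weightSpace ρ m fun l => ∑ r : Fin d, if r.succ ≤ m l then x 0 - x r.succ else 0 := by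
  intro v hv
  rw [mem_weightSpace_iff]
  intro t
  rw [expLayer_eq, apply_diagSL_of_mem hv, dotProduct_layerExp]
  congr 2
  simp only [layerCoeff, Finset.sum_mul, Finset.mul_sum]
  rw [Finset.sum_comm]
  refine Finset.sum_congr rfl fun l _ => Finset.sum_congr rfl fun r _ => ?_
  split_ifs <;> simp

theorem iSupIndep_weightSpace (m : Fin k → Fin (d + 1)) : iSupIndep (weightSpace ρ m) := by
  rw [iSupIndep_iff_finsetSum_eq_zero_imp_eq_zero]
  intro S v hv hs i hi
  have := mem_of_sum_mem (fun t => ρ (expLayer m t)) ⊥ (by simp)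
    (fun (μ t : Fin k → ℝ) => Real.exp (∑ l, t l * μ l)) (fun μ μ' h => by
      funext l
      have := congrFun h (Pi.single l 1)
      simpa [Pi.single_apply] using this) S v
    (fun j hj t => mem_weightSpace_iff.mp (hv j hj) t) (by simp [hs]) i hi
  simpa using this

theorem isCompl_weightSpace (hρ : ∀ v : V, Continuous fun g => ρ g v) (m : Fin k → Fin (d + 1))
    (μ : Fin k → ℝ) :
    IsCompl (weightSpace ρ m μ) (⨆ ν : {ν : Fin k → ℝ // ν ≠ μ}, weightSpace ρ m ν.1) := by
  constructor
  · have := iSupIndep_weightSpace (ρ := ρ) m μ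
    rwa [iSup_subtype']  at this
  · rw [codisjoint_iff, eq_top_iff, ← iSup_torusWeight_eq_top hρ]
    refine iSup_le fun x => (torusWeight_le_weightSpace m x).trans ?_
    set ν : Fin k → ℝ := fun l => ∑ r : Fin d, if r.succ ≤ m l then x 0 - x r.succ else 0
    by_cases h : ν = μ
    · rw [h]; exact le_sup_left
    · exact (le_iSup (fun ν : {ν : Fin k → ℝ // ν ≠ μ} => weightSpace ρ m ν.1) ⟨ν, h⟩).trans
        le_sup_right

theorem weightProj_apply_of_mem (hρ : ∀ v : V, Continuous fun g => ρ g v)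
    {m : Fin k → Fin (d + 1)} {μ : Fin k → ℝ} {v : V} (hv : v ∈ weightSpace ρ m μ) :
    weightProj ρ m μ v = v := by
  rw [weightProj, projAlong, dif_pos (isCompl_weightSpace hρ m μ)]
  exact Submodule.projection_apply_of_mem_left _ hv

theorem weightProj_mem (hρ : ∀ v : V, Continuous fun g => ρ g v)
    (m : Fin k → Fin (d + 1)) (μ : Fin k → ℝ) (v : V) :
    weightProj ρ m μ v ∈ weightSpace ρ m μ := by
  rw [weightProj, projAlong, dif_pos (isCompl_weightSpace hρ m μ)]
  exact Submodule.projection_apply_mem _ v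

/-- The weight projections commute with the centralizer of the layers. -/
theorem weightProj_apply_comm (hρ : ∀ v : V, Continuous fun g => ρ g v)
    {m : Fin k → Fin (d + 1)} (μ : Fin k → ℝ) {g : SL(d + 1, ℝ)}
    (hg : ∀ t, g * expLayer m t = expLayer m t * g) (v : V) :
    weightProj ρ m μ (ρ g v) = ρ g (weightProj ρ m μ v) := by
  have hmem : ∀ ν, weightSpace ρ m ν ≤ (weightSpace ρ m ν).comap (ρ g) := by
    intro ν w hw
    rw [Submodule.mem_comap, mem_weightSpace_iff]
    intro t
    rw [← Module.End.mul_apply, ← map_mul, ← hg, map_mul, Module.End.mul_apply,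
      mem_weightSpace_iff.mp hw, map_smul]
  rw [weightProj, projAlong, dif_pos (isCompl_weightSpace hρ m μ)]
  set hc := isCompl_weightSpace hρ m μ
  have h2 : (⨆ ν : {ν : Fin k → ℝ // ν ≠ μ}, weightSpace ρ m ν.1) ≤
      (⨆ ν : {ν : Fin k → ℝ // ν ≠ μ}, weightSpace ρ m ν.1).comap (ρ g) :=
    iSup_le fun ν => (hmem ν.1).trans (Submodule.comap_mono
      (le_iSup (fun ν : {ν : Fin k → ℝ // ν ≠ μ} => weightSpace ρ m ν.1) ν))
  have h3 := h2 (Submodule.sub_projection_mem hc v)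
  have h4 := hmem μ (Submodule.projection_apply_mem hc v)
  rw [Submodule.mem_comap, map_sub] at h3
  rw [Submodule.mem_comap] at h4
  have h5 := (Submodule.projection_apply_eq_zero_iff hc).mpr h3
  rw [map_sub, sub_eq_zero] at h5
  rw [h5, Submodule.projection_apply_of_mem_left hc h4]

theorem apply_mem_boundedSubmodule_of_comm {m : Fin k → Fin (d + 1)} {T : ℕ → Fin k → ℝ}
    {g : SL(d + 1, ℝ)} (hg : ∀ t, g * expLayer m t = expLayer m t * g) {v : V}
    (hv : v ∈ boundedSubmodule ρ m T) : ρ g v ∈ boundedSubmodule ρ m T := by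
  obtain ⟨C, hC⟩ := hv
  refine ⟨‖LinearMap.toContinuousLinearMap (ρ g)‖ * C, fun i => ?_⟩
  rw [← Module.End.mul_apply, ← map_mul, ← hg, map_mul, Module.End.mul_apply]
  exact ((LinearMap.toContinuousLinearMap (ρ g)).le_opNorm _).trans
    (mul_le_mul_of_nonneg_left (hC i) (norm_nonneg _))

/-- The layers do not change the zero weight component. -/
theorem weightProj_zero_apply_expLayer (hρ : ∀ v : V, Continuous fun g => ρ g v)
    {m : Fin k → Fin (d + 1)} (t : Fin k → ℝ) (w : V) :
    weightProj ρ m 0 (ρ (expLayer m t) w) = weightProj ρ m 0 w := by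
  rw [weightProj_apply_comm hρ 0 (fun s => by rw [← expLayer_add, add_comm t s, expLayer_add]),
    mem_weightSpace_iff.mp (weightProj_mem hρ m 0 w)]
  simp

/-- A vector of `V⁻(𝒯)` has no zero weight component. -/
theorem weightProj_zero_eq_zero_of_mem_Vminus (hρ : ∀ v : V, Continuous fun g => ρ g v)
    {m : Fin k → Fin (d + 1)} {T : ℕ → Fin k → ℝ} {v : V} (hv : v ∈ Vminus ρ m T) :
    weightProj ρ m 0 v = 0 := by
  have h1 := ((weightProj ρ m 0).continuous_of_finiteDimensional.tendsto 0).comp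
    (show Filter.Tendsto (fun i => ρ (expLayer m (T i)) v) Filter.atTop (nhds 0) from hv)
  simp only [Function.comp_def, weightProj_zero_apply_expLayer hρ, map_zero] at h1
  exact tendsto_nhds_unique tendsto_const_nhds h1

/-- Elements whose conjugates by the layers converge to the centralizer of the layers preserve the
vectors with bounded trajectory, and act on their zero weight components through the limit. -/
theorem weightProj_apply_of_tendsto_conj (hρ : ∀ v : V, Continuous fun g => ρ g v)
    {m : Fin k → Fin (d + 1)} {T : ℕ → Fin k → ℝ} {p p₀ : SL(d + 1, ℝ)}
    (hp : Filter.Tendsto (fun i => expLayer m (T i) * p * expLayer m (-T i)) Filter.atTop (nhds p₀))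
    (hp₀ : ∀ t, p₀ * expLayer m t = expLayer m t * p₀) {v : V}
    (hv : v ∈ boundedSubmodule ρ m T) :
    ρ p v ∈ boundedSubmodule ρ m T ∧ weightProj ρ m 0 (ρ p v) = ρ p₀ (weightProj ρ m 0 v) := by
  let Φ : SL(d + 1, ℝ) → V →L[ℝ] V := fun g => LinearMap.toContinuousLinearMap (ρ g)
  have hΦ : Filter.Tendsto (fun i => Φ (expLayer m (T i) * p * expLayer m (-T i))) Filter.atTop
      (nhds (Φ p₀)) := ((continuous_toContinuousLinearMap hρ).tendsto p₀).comp hp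
  obtain ⟨C, hC⟩ := hv
  have hconj : ∀ i, ρ (expLayer m (T i)) (ρ p v) =
      Φ (expLayer m (T i) * p * expLayer m (-T i)) (ρ (expLayer m (T i)) v) := by
    intro i
    simp only [Φ, LinearMap.coe_toContinuousLinearMap']
    rw [← Module.End.mul_apply, ← Module.End.mul_apply, ← map_mul, ← map_mul, mul_assoc _ _
      (expLayer m (T i)), expLayer_neg_mul, mul_one]
  refine ⟨?_, ?_⟩
  · obtain ⟨D, hD⟩ := hΦ.norm.bddAbove_range
    refine ⟨D * C, fun i => ?_⟩
    rw [hconj]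
    exact (ContinuousLinearMap.le_opNorm _ _).trans (mul_le_mul (hD ⟨i, rfl⟩) (hC i)
      (norm_nonneg _) ((norm_nonneg _).trans (hD ⟨i, rfl⟩)))
  · have hfix := fun t w => weightProj_zero_apply_expLayer (ρ := ρ) (m := m) hρ t w
    -- The zero weight component is constant along trajectories, so the difference may be evaluated
    -- at time `i`, where a factor tending to zero acts on a bounded vector.
    have h1 : ∀ i, weightProj ρ m 0 (ρ p v) - ρ p₀ (weightProj ρ m 0 v) =
        weightProj ρ m 0 ((Φ (expLayer m (T i) * p * expLayer m (-T i)) - Φ p₀)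
          (ρ (expLayer m (T i)) v)) := by
      intro i
      rw [_root_.sub_apply, map_sub, ← hconj, hfix]
      congr 1
      simp only [Φ, LinearMap.coe_toContinuousLinearMap']
      rw [weightProj_apply_comm hρ 0 hp₀, hfix]
    have h2 : Filter.Tendsto (fun i => (Φ (expLayer m (T i) * p * expLayer m (-T i)) - Φ p₀)
        (ρ (expLayer m (T i)) v)) Filter.atTop (nhds 0) := by
      have h3 : Filter.Tendsto (fun i =>
          ‖Φ (expLayer m (T i) * p * expLayer m (-T i)) - Φ p₀‖ * C) Filter.atTop (nhds 0) := by
        have := (tendsto_iff_norm_sub_tendsto_zero.mp hΦ).mul_const C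
        rwa [zero_mul] at this
      refine squeeze_zero_norm (fun i => ?_) h3
      exact (ContinuousLinearMap.le_opNorm _ _).trans
        (mul_le_mul_of_nonneg_left (hC i) (norm_nonneg _))
    have h3 := ((weightProj ρ m 0).continuous_of_finiteDimensional.tendsto 0).comp h2
    rw [map_zero] at h3
    have h4 := h3.congr fun i => (h1 i).symm
    exact sub_eq_zero.mp (tendsto_nhds_unique tendsto_const_nhds h4)

end Layers

open Matrix Filter Topology

/-! ### Row reduction with a prescribed row order -/

section Echelon

variable {n : ℕ}

theorem exists_leading {x : Fin n → ℝ} (hx : x ≠ 0) : ∃ j, (∀ c < j, x c = 0) ∧ x j ≠ 0 := by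
  obtain ⟨i, hi⟩ := Function.ne_iff.mp hx
  obtain ⟨j, hj, hmin⟩ := (wellFounded_lt (α := Fin n)).has_min {j | x j ≠ 0} ⟨i, hi⟩
  exact ⟨j, fun c hc => by_contra fun h => hmin c h hc, hj⟩

/-- Row reduction by matrices that are unipotent and triangular for the order of the rows
given by `κ`. -/
theorem exists_echelon (κ : Equiv.Perm (Fin n)) {h : Matrix (Fin n) (Fin n) ℝ} (hdet : h.det ≠ 0) :
    ∃ p : Matrix (Fin n) (Fin n) ℝ, p.det = 1 ∧ (∀ q i, κ q < κ i → p q i = 0) ∧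
      (∀ q, p q q = 1) ∧
      ∃ π : Equiv.Perm (Fin n), ∀ q, (∀ c < π q, (p * h) q c = 0) ∧ (p * h) q (π q) ≠ 0 := by
  -- The candidates for row `q` of `p`. Each row is chosen to push the leading position of its
  -- product with `h` as far right as possible.
  let A : Fin n → Set (Fin n → ℝ) := fun q => {a | a q = 1 ∧ ∀ i, κ q < κ i → a i = 0}
  have hne : ∀ q, ∀ a ∈ A q, a ᵥ* h ≠ 0 := by
    intro q a ha h0
    have := eq_zero_of_vecMul_eq_zero hdet h0
    have h1 := ha.1
    rw [this] at h1
    exact zero_ne_one h1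
  have hmax : ∀ q, ∃ j, ∃ a ∈ A q, (∀ c < j, (a ᵥ* h) c = 0) ∧ (a ᵥ* h) j ≠ 0 ∧
      ∀ b ∈ A q, (∀ c ≤ j, (b ᵥ* h) c = 0) → False := by
    intro q
    have hsingle : (Pi.single q 1 : Fin n → ℝ) ∈ A q :=
      ⟨Pi.single_eq_same _ _, fun i hi => Pi.single_eq_of_ne (by rintro rfl; exact lt_irrefl _ hi) _⟩
    obtain ⟨j₀, hj₀⟩ := exists_leading (hne q _ hsingle)
    obtain ⟨j, ⟨a, ha, h1, h2⟩, hj⟩ := (wellFounded_gt (α := Fin n)).has_min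
      {j | ∃ a ∈ A q, (∀ c < j, (a ᵥ* h) c = 0) ∧ (a ᵥ* h) j ≠ 0} ⟨j₀, _, hsingle, hj₀⟩
    refine ⟨j, a, ha, h1, h2, fun b hb hbj => ?_⟩
    obtain ⟨j', h3, h4⟩ := exists_leading (hne q b hb)
    refine hj j' ⟨b, hb, h3, h4⟩ ?_
    by_contra hlt
    exact h4 (hbj j' (not_lt.mp hlt))
  choose π a ha hlead hpiv hmax using hmax
  have hinj : ∀ q q', κ q < κ q' → π q ≠ π q' := by
    intro q q' hlt heq
    set c := (a q' ᵥ* h) (π q') / (a q ᵥ* h) (π q') with hc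
    -- If two rows had the same pivot, subtracting a multiple of the earlier row would move the
    -- pivot of the later one further right.
    refine hmax q' (a q' - c • a q) ⟨?_, fun i hi => ?_⟩ fun j hj => ?_
    · simp [(ha q').1, (ha q).2 q' hlt]
    · simp [(ha q').2 i hi, (ha q).2 i (hlt.trans hi)]
    · rw [sub_vecMul, smul_vecMul, Pi.sub_apply, Pi.smul_apply, smul_eq_mul]
      rcases hj.lt_or_eq with hj | rfl
      · rw [hlead q' j hj, hlead q j (heq ▸ hj), mul_zero, sub_zero]
      · rw [hc, div_mul_cancel₀ _ (heq ▸ hpiv q), sub_self]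
  have hπ : Function.Injective π := by
    intro q q' heq
    rcases lt_trichotomy (κ q) (κ q') with hlt | he | hlt
    · exact absurd heq (hinj q q' hlt)
    · exact κ.injective he
    · exact absurd heq.symm (hinj q' q hlt)
  refine ⟨Matrix.of a, ?_, fun q i hi => (ha q).2 i hi, fun q => (ha q).1,
    Equiv.ofBijective π (Finite.injective_iff_bijective.mp hπ), fun q => ?_⟩
  · rw [← det_submatrix_equiv_self κ.symm, det_of_isLowerTriangular]
    · exact Finset.prod_eq_one fun q _ => (ha _).1
    · intro q i hi
      exact (ha _).2 _ (by simpa using hi)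
  · have h1 : (Matrix.of a * h) q = a q ᵥ* h := rfl
    rw [h1]
    exact ⟨hlead q, hpiv q⟩

end Echelon

/-! ### Limits of conjugates under the layers -/

section Limits

variable {n : ℕ}

/-- The determinant is continuous, so an entrywise limit stays in `SL`. -/
theorem exists_tendsto_of_entries {β : Type*} {l : Filter β} [l.NeBot] {g : β → SL(n, ℝ)}
    {P : Matrix (Fin n) (Fin n) ℝ} (h : ∀ i j, Tendsto (fun b => g b i j) l (𝓝 (P i j))) :
    ∃ p : SL(n, ℝ), (p : Matrix (Fin n) (Fin n) ℝ) = P ∧ Tendsto g l (𝓝 p) := by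
  have h1 : Tendsto (fun b => (g b : Matrix (Fin n) (Fin n) ℝ)) l (𝓝 P) :=
    tendsto_pi_nhds.mpr fun i => tendsto_pi_nhds.mpr fun j => h i j
  have hdet : P.det = 1 := by
    have h2 : Tendsto (fun b => (g b : Matrix (Fin n) (Fin n) ℝ).det) l (𝓝 P.det) :=
      ((continuous_id.matrix_det).tendsto P).comp h1
    simp only [Matrix.SpecialLinearGroup.det_coe] at h2
    exact tendsto_nhds_unique h2 tendsto_const_nhds
  exact ⟨⟨P, hdet⟩, rfl, Topology.IsInducing.subtypeVal.tendsto_nhds_iff.mpr h1⟩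

end Limits

section Parabolic

variable {d k : ℕ}

theorem layerExp_neg (m : Fin k → Fin (d + 1)) (t : Fin k → ℝ) :
    layerExp m (-t) = -layerExp m t := by
  rw [eq_neg_iff_add_eq_zero, ← layerExp_add, neg_add_cancel]
  funext i
  rcases Fin.eq_zero_or_eq_succ i with rfl | ⟨j, rfl⟩
  · simp [layerExp_zero, layerCoeff]
  · simp [layerExp_succ, layerCoeff]

theorem conj_expLayer_apply (m : Fin k → Fin (d + 1)) (t : Fin k → ℝ) (p : SL(d + 1, ℝ))
    (i j : Fin (d + 1)) :
    (expLayer m t * p * expLayer m (-t)) i j =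
      Real.exp (layerExp m t i - layerExp m t j) * p i j := by
  rw [expLayer_eq, expLayer_eq, layerExp_neg, diagSL_mul_mul_apply _ _ rfl]

theorem layerCoeff_nonneg (m : Fin k → Fin (d + 1)) {t : Fin k → ℝ} (ht : ∀ l, 0 ≤ t l)
    (r : Fin d) : 0 ≤ layerCoeff m t r :=
  Finset.sum_nonneg fun l _ => by split_ifs <;> simp [ht]

theorem le_layerCoeff (m : Fin k → Fin (d + 1)) {t : Fin k → ℝ} (ht : ∀ l, 0 ≤ t l)
    {r : Fin d} {l : Fin k} (hl : r.succ ≤ m l) : t l ≤ layerCoeff m t r := by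
  have := Finset.single_le_sum (f := fun l => if r.succ ≤ m l then t l else 0)
    (fun l _ => by split_ifs <;> simp [ht]) (Finset.mem_univ l)
  rw [layerCoeff]
  simpa [hl] using this

/-- Negation fixes `0` and sends `i ≠ 0` to `d + 1 - i`, so the row order is `0, d, d-1, …, 1`: row
`0` comes first and later layer rows precede earlier ones. -/
theorem neg_le_neg_cases {i j : Fin (d + 1)} (h : -j ≤ -i) : i = j ∨ (i ≠ 0 ∧ (j = 0 ∨ i ≤ j)) := by
  rw [Fin.le_def, Fin.val_neg, Fin.val_neg] at h
  by_cases hi : i = 0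
  · left
    by_cases hj : j = 0
    · rw [hi, hj]
    · have := j.2
      simp only [hi, hj, if_true, if_false] at h
      omega
  · right
    refine ⟨hi, ?_⟩
    by_cases hj : j = 0
    · exact Or.inl hj
    · right
      simp only [hi, hj, if_false] at h
      rw [Fin.le_def]
      omega

/-- For the row order given by negation, the conjugates of triangular matrices by the layers
converge. -/
theorem layerExp_sub_dichotomy {m : Fin k → Fin (d + 1)} (hk : 1 ≤ k) (hm_pos : ∀ l, 0 < m l)
    {T : ℕ → Fin k → ℝ} (hT_nonneg : ∀ i l, 0 ≤ T i l)
    (hT : ∀ l, Tendsto (fun i => T i l) atTop atTop) {i j : Fin (d + 1)} (hij : -j ≤ -i) :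
    (∀ t, layerExp m t i = layerExp m t j) ∨
      Tendsto (fun a => layerExp m (T a) i - layerExp m (T a) j) atTop atBot := by
  rcases neg_le_neg_cases hij with rfl | ⟨hi, hj⟩
  · exact Or.inl fun _ => rfl
  obtain ⟨r, rfl⟩ := Fin.exists_succ_eq.mpr hi
  rcases Fin.eq_zero_or_eq_succ j with rfl | ⟨r', rfl⟩
  · right
    let l₀ : Fin k := ⟨0, hk⟩
    have : Nonempty (Fin d) := ⟨r⟩
    obtain ⟨r₀, hr₀⟩ := Fin.exists_succ_eq.mpr (hm_pos l₀).ne'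
    have hlim : Tendsto (fun a => -T a l₀) atTop atBot := tendsto_neg_atTop_atBot.comp (hT l₀)
    refine tendsto_atBot_mono (fun a => ?_) hlim
    rw [layerExp_zero, layerExp_succ]
    have h1 := layerCoeff_nonneg m (hT_nonneg a) r
    have h2 := le_layerCoeff m (hT_nonneg a) (r := r₀) (l := l₀) hr₀.le
    have h3 := Finset.single_le_sum (f := layerCoeff m (T a))
      (fun r _ => layerCoeff_nonneg m (hT_nonneg a) r) (Finset.mem_univ r₀)
    linarith
  · have hle : r.succ ≤ r'.succ := hj.resolve_left (Fin.succ_ne_zero r')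
    have hdiff : ∀ t, layerExp m t r.succ - layerExp m t r'.succ =
        -∑ l, if r.succ ≤ m l ∧ m l < r'.succ then t l else 0 := by
      intro t
      rw [layerExp_succ, layerExp_succ, layerCoeff, layerCoeff, neg_sub_neg, ← Finset.sum_sub_distrib,
        ← Finset.sum_neg_distrib]
      refine Finset.sum_congr rfl fun l _ => ?_
      by_cases h1 : r'.succ ≤ m l
      · simp [h1, hle.trans h1, not_lt.mpr h1]
      · simp [h1, not_le.mp h1]
    by_cases hl : ∃ l, r.succ ≤ m l ∧ m l < r'.succ
    · right
      obtain ⟨l, hl⟩ := hl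
      have hlim : Tendsto (fun a => -T a l) atTop atBot := tendsto_neg_atTop_atBot.comp (hT l)
      refine tendsto_atBot_mono (fun a => ?_) hlim
      rw [hdiff]
      have := Finset.single_le_sum
        (f := fun l => if r.succ ≤ m l ∧ m l < r'.succ then T a l else 0)
        (fun l _ => by split_ifs <;> simp [hT_nonneg]) (Finset.mem_univ l)
      simp only [hl, and_self, if_true] at this
      linarith
    · left
      intro t
      rw [← sub_eq_zero, hdiff, neg_eq_zero]
      exact Finset.sum_eq_zero fun l _ => if_neg fun h => hl ⟨l, h⟩

/-- For the row order given by negation, the conjugates of triangular matrices by the layers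
converge to the centralizer of the layers. -/
theorem exists_tendsto_conj_expLayer {m : Fin k → Fin (d + 1)} (hk : 1 ≤ k)
    (hm_pos : ∀ l, 0 < m l)
    {T : ℕ → Fin k → ℝ} (hT_nonneg : ∀ i l, 0 ≤ T i l)
    (hT : ∀ l, Tendsto (fun i => T i l) atTop atTop) {p : SL(d + 1, ℝ)}
    (hp : ∀ i j, -i < -j → p i j = 0) :
    ∃ p₀ : SL(d + 1, ℝ), (∀ t, p₀ * expLayer m t = expLayer m t * p₀) ∧
      Tendsto (fun i => expLayer m (T i) * p * expLayer m (-T i)) atTop (𝓝 p₀) := by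
  classical
  -- The limit keeps exactly the entries whose two indices have equal exponents for all `t`; such a
  -- matrix commutes with the layers.
  obtain ⟨p₀, hp₀, hlim⟩ := exists_tendsto_of_entries (l := atTop)
    (g := fun i => expLayer m (T i) * p * expLayer m (-T i))
    (P := Matrix.of fun i j => if ∀ t, layerExp m t i = layerExp m t j then p i j else 0) (by
      intro i j
      simp only [conj_expLayer_apply, Matrix.of_apply]
      by_cases hij : -i < -j
      · simp [hp i j hij]
      · by_cases heq : ∀ t, layerExp m t i = layerExp m t j
        · rw [if_pos heq]
          simp [heq]
        · rw [if_neg heq, ← zero_mul (p i j)]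
          exact (Real.tendsto_exp_atBot.comp ((layerExp_sub_dichotomy hk hm_pos hT_nonneg hT
            (not_lt.mp hij)).resolve_left heq)).mul_const _)
  refine ⟨p₀, fun t => ?_, hlim⟩
  refine eq_of_coe_eq ?_
  rw [Matrix.SpecialLinearGroup.coe_mul, Matrix.SpecialLinearGroup.coe_mul, hp₀, expLayer_eq,
    coe_diagSL_of_sum_eq_zero (sum_layerExp m t)]
  ext i j
  rw [mul_diagonal, diagonal_mul, Matrix.of_apply]
  split_ifs with h
  · rw [h, mul_comm]
  · simp

end Parabolic

/-! ### Degeneration to monomial matrices -/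

section Degeneration

variable {d : ℕ} {V : Type*} [NormedAddCommGroup V] [NormedSpace ℝ V]
  {ρ : Representation ℝ SL(d + 1, ℝ) V}

theorem monomial_mul_diagSL {w : SL(d + 1, ℝ)} {π : Equiv.Perm (Fin (d + 1))}
    (hw : ∀ q c, c ≠ π q → w q c = 0) (y : Fin (d + 1) → ℝ) :
    w * diagSL y = diagSL (y ∘ π) * w := by
  refine eq_of_coe_eq ?_
  rw [Matrix.SpecialLinearGroup.coe_mul, Matrix.SpecialLinearGroup.coe_mul, coe_diagSL, coe_diagSL]
  ext q c
  rw [mul_diagonal, diagonal_mul]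
  by_cases hc : c = π q
  · subst hc
    rw [mul_comm, Equiv.sum_comp π y |>.symm]
    rfl
  · rw [hw q c hc, zero_mul, mul_zero]

theorem apply_monomial_mem_torusWeight {w : SL(d + 1, ℝ)} {π : Equiv.Perm (Fin (d + 1))}
    (hw : ∀ q c, c ≠ π q → w q c = 0) {x : Fin (d + 1) → ℝ} {v : V} (hv : v ∈ torusWeight ρ x) :
    ρ w v ∈ torusWeight ρ (x ∘ π) := by
  intro y
  have h1 := monomial_mul_diagSL hw (y ∘ π.symm)
  have h2 : (y ∘ π.symm) ∘ π = y := by funext i; simp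
  rw [h2] at h1
  rw [← Module.End.mul_apply, ← map_mul, ← h1, map_mul, Module.End.mul_apply,
    apply_diagSL_of_mem hv, map_smul]
  congr 2
  rw [dotProduct, dotProduct, ← Equiv.sum_comp π]
  simp

/-- Degeneration of an element in echelon form to a monomial matrix: the translates of the extremal
weight components of a vector lie in every torus invariant subspace that contains the translate of
the vector. -/
theorem exists_monomial_apply_mem [FiniteDimensional ℝ V]
    (hρ : ∀ v : V, Continuous fun g => ρ g v) {Z : Submodule ℝ V}
    (hZ : ∀ y, ∀ z ∈ Z, ρ (diagSL y) z ∈ Z) {h : SL(d + 1, ℝ)} {π : Equiv.Perm (Fin (d + 1))}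
    (hπ : ∀ q, ∀ c < π q, h q c = 0) {S : Finset (Fin (d + 1) → ℝ)} {v : (Fin (d + 1) → ℝ) → V}
    (hv : ∀ x ∈ S, v x ∈ torusWeight ρ x) (hS : ρ h (∑ x ∈ S, v x) ∈ Z)
    {x₀ : Fin (d + 1) → ℝ} (hx₀ : x₀ ∈ S)
    (hmax : ∀ x ∈ S, x ⬝ᵥ (fun c => (c : ℝ)) ≤ x₀ ⬝ᵥ fun c => (c : ℝ)) :
    ∃ w : SL(d + 1, ℝ), (∀ q c, c ≠ π q → w q c = 0) ∧ ρ w (v x₀) ∈ Z := by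
  classical
  set y₀ : Fin (d + 1) → ℝ := fun c => (c : ℝ) with hy₀
  -- Conjugation fixes the pivot entries, the entries left of the pivots are zero already, and those
  -- to the right decay.
  obtain ⟨w, hw, hlim⟩ := exists_tendsto_of_entries (l := (atTop : Filter ℝ))
    (g := fun s => diagSL (s • (y₀ ∘ π)) * h * diagSL (-(s • y₀)))
    (P := Matrix.of fun q c => if c = π q then h q c else 0) (by
      intro q c
      have hsum : ∀ s : ℝ, ∑ i, (s • (y₀ ∘ π)) i = ∑ i, (s • y₀) i := fun s => by
        simp only [Pi.smul_apply, Function.comp_apply]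
        exact Equiv.sum_comp π fun i => s • y₀ i
      simp only [diagSL_mul_mul_apply _ _ (hsum _), Matrix.of_apply]
      rcases lt_trichotomy c (π q) with hc | rfl | hc
      · simp [hπ q c hc, hc.ne]
      · simp
      · rw [if_neg hc.ne', ← zero_mul (h q c)]
        refine Tendsto.mul_const _ (Real.tendsto_exp_atBot.comp ?_)
        have h1 : ∀ s : ℝ, (s • (y₀ ∘ π)) q - (s • y₀) c = s * (y₀ (π q) - y₀ c) := fun s => by
          simp only [Pi.smul_apply, Function.comp_apply, smul_eq_mul]; ring
        simp only [h1]
        refine tendsto_id.atTop_mul_const_of_neg ?_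
        rw [sub_neg]
        exact Nat.cast_lt.mpr (Fin.lt_def.mp hc))
  have hw0 : ∀ q c, c ≠ π q → w q c = 0 := fun q c hc => by
    have := congrFun (congrFun hw q) c
    rw [Matrix.of_apply, if_neg hc] at this
    exact this
  refine ⟨w, hw0, ?_⟩
  set M := x₀ ⬝ᵥ y₀ with hM
  let vtop : (Fin (d + 1) → ℝ) → V := fun x => if x ⬝ᵥ y₀ = M then v x else 0
  have hscale : Tendsto (fun s : ℝ => ∑ x ∈ S, Real.exp (s * (x ⬝ᵥ y₀ - M)) • v x) atTop
      (𝓝 (∑ x ∈ S, vtop x)) := by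
    refine tendsto_finsetSum _ fun x hx => ?_
    by_cases hxM : x ⬝ᵥ y₀ = M
    · simp [vtop, hxM]
    · simp only [vtop, if_neg hxM]
      rw [← zero_smul ℝ (v x)]
      refine Tendsto.smul_const (Real.tendsto_exp_atBot.comp ?_) _
      exact tendsto_id.atTop_mul_const_of_neg (sub_neg.mpr (lt_of_le_of_ne (hmax x hx) hxM))
  have hmem : ∀ s : ℝ, ρ (diagSL (s • (y₀ ∘ π)) * h * diagSL (-(s • y₀)))
      (∑ x ∈ S, Real.exp (s * (x ⬝ᵥ y₀ - M)) • v x) ∈ Z := by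
    intro s
    -- Rescaling by `exp (-(s * M))` keeps the terms of maximal pairing with `y₀` and damps the
    -- others.
    have h1 : ∑ x ∈ S, Real.exp (s * (x ⬝ᵥ y₀ - M)) • v x =
        Real.exp (-(s * M)) • ρ (diagSL (s • y₀)) (∑ x ∈ S, v x) := by
      rw [map_sum, Finset.smul_sum]
      refine Finset.sum_congr rfl fun x hx => ?_
      rw [apply_diagSL_of_mem (hv x hx), smul_smul, ← Real.exp_add, dotProduct_smul, smul_eq_mul]
      congr 2
      ring
    have h2 : diagSL (-(s • y₀)) * diagSL (s • y₀) = 1 := by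
      rw [← diagSL_add, neg_add_cancel, diagSL_zero]
    rw [h1, map_smul, ← Module.End.mul_apply, ← map_mul, mul_assoc, h2, mul_one, map_mul,
      Module.End.mul_apply]
    exact Z.smul_mem _ (hZ _ _ hS)
  have hΦ : Tendsto (fun s : ℝ => LinearMap.toContinuousLinearMap
      (ρ (diagSL (s • (y₀ ∘ π)) * h * diagSL (-(s • y₀))))) atTop
      (𝓝 (LinearMap.toContinuousLinearMap (ρ w))) :=
    ((continuous_toContinuousLinearMap hρ).tendsto w).comp hlim
  have htop : ρ w (∑ x ∈ S, vtop x) ∈ Z :=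
    Z.closed_of_finiteDimensional.mem_of_tendsto
      (((isBoundedBilinearMap_apply (𝕜 := ℝ) (E := V) (F := V)).continuous.tendsto (_, _)).comp
        (hΦ.prodMk_nhds hscale)) (Eventually.of_forall hmem)
  -- Several weights may attain the maximum. The preimage of `Z` under `w` is torus invariant
  -- because `w` normalizes the torus, so the weight components separate.
  have := mem_of_sum_mem (fun y => ρ (diagSL y)) (Z.comap (ρ w)) (fun y z hz => by
      rw [Submodule.mem_comap, ← Module.End.mul_apply, ← map_mul, monomial_mul_diagSL hw0, map_mul,
        Module.End.mul_apply]
      exact hZ _ _ hz) (fun x y => Real.exp (x ⬝ᵥ y)) exp_dotProduct_injective S vtop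
    (fun x hx y => by
      by_cases hxM : x ⬝ᵥ y₀ = M
      · simp only [vtop, if_pos hxM]
        exact apply_diagSL_of_mem (hv x hx) y
      · simp [vtop, hxM]) htop x₀ hx₀
  have hx₀top : vtop x₀ = v x₀ := if_pos rfl
  rwa [hx₀top] at this

end Degeneration

/-! ### Pivots and coordinates of the points of the affine basis -/

section Pivots

variable {d : ℕ}

theorem vecMul_u (z : Fin (d + 1) → ℝ) (e : Fin d → ℝ) :
    z ᵥ* (u e : Matrix (Fin (d + 1)) (Fin (d + 1)) ℝ) =
      Fin.cons (z 0) fun r => z 0 * e r + z r.succ := by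
  have h0 : (u e : Matrix (Fin (d + 1)) (Fin (d + 1)) ℝ) =
      Matrix.of (Fin.cons (Fin.cons 1 e) fun i => Pi.single i.succ 1) := rfl
  funext c
  rw [h0, vecMul, dotProduct, Fin.sum_univ_succ]
  rcases Fin.eq_zero_or_eq_succ c with rfl | ⟨j, rfl⟩
  · simp [(Fin.succ_ne_zero _).symm]
  · simp [Pi.single_apply]

/-- The projective coordinate matrix of an affine basis, scaled to have determinant `1`. -/
theorem exists_coordinate_matrix {E : Fin (d + 1) → Fin d → ℝ} (hE : AffineIndependent ℝ E) :
    ∃ (M : SL(d + 1, ℝ)) (δ : Fin (d + 1) → ℝ), (∀ j, δ j ≠ 0) ∧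
      ∀ j, M j = δ j • (Fin.cons 1 (E j) : Fin (d + 1) → ℝ) := by
  let M₀ : Matrix (Fin (d + 1)) (Fin (d + 1)) ℝ := Matrix.of fun j => Fin.cons 1 (E j)
  have hM₀ : M₀.det ≠ 0 := by
    have hli : LinearIndependent ℝ M₀.row := by
      rw [Fintype.linearIndependent_iff]
      intro c hc
      rw [affineIndependent_iff] at hE
      have h0 : ∑ j, c j = 0 := by
        have := congrFun hc 0
        simpa [M₀, Finset.sum_apply] using this
      have h1 : ∑ j, c j • E j = 0 := by
        funext r
        have := congrFun hc r.succ
        simpa [M₀, Finset.sum_apply] using this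
      exact fun j => hE Finset.univ c h0 h1 j (Finset.mem_univ j)
    rw [linearIndependent_rows_iff_isUnit] at hli
    exact ((isUnit_iff_isUnit_det M₀).mp hli).ne_zero
  let δ : Fin (d + 1) → ℝ := Fin.cons M₀.det⁻¹ fun _ => 1
  refine ⟨⟨diagonal δ * M₀, ?_⟩, δ, ?_, ?_⟩
  · rw [det_mul, det_diagonal, Fin.prod_univ_succ]
    simp [δ, hM₀]
  · intro j
    rcases Fin.eq_zero_or_eq_succ j with rfl | ⟨r, rfl⟩
    · simpa [δ] using hM₀
    · simp [δ]
  · intro j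
    funext c
    change (diagonal δ * M₀) j c = _
    rw [diagonal_mul]
    rfl

variable {E : Fin (d + 1) → Fin d → ℝ} {M : SL(d + 1, ℝ)} {δ : Fin (d + 1) → ℝ}
  {P H : Matrix (Fin (d + 1)) (Fin (d + 1)) ℝ} {π : Equiv.Perm (Fin (d + 1))} {j : Fin (d + 1)}

theorem single_vecMul_coordinate (hM : ∀ j, M j = δ j • (Fin.cons 1 (E j) : Fin (d + 1) → ℝ))
    (i : Fin (d + 1)) (a : ℝ) :
    (Pi.single i a : Fin (d + 1) → ℝ) ᵥ* (M : Matrix (Fin (d + 1)) (Fin (d + 1)) ℝ) =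
      (a * δ i) • (Fin.cons 1 (E i) : Fin (d + 1) → ℝ) := by
  rw [single_vecMul, mul_smul]
  congr 1
  exact hM i

theorem vecMul_coordinate_injective {x y : Fin (d + 1) → ℝ}
    (h : x ᵥ* (M : Matrix (Fin (d + 1)) (Fin (d + 1)) ℝ) =
      y ᵥ* (M : Matrix (Fin (d + 1)) (Fin (d + 1)) ℝ)) : x = y := by
  rw [← sub_eq_zero, ← sub_vecMul] at h
  exact sub_eq_zero.mp (eq_zero_of_vecMul_eq_zero (Matrix.SpecialLinearGroup.det_ne_zero M) h)

/-- The first pivot. -/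
theorem pivot_zero (hδ : ∀ j, δ j ≠ 0)
    (hM : ∀ j, M j = δ j • (Fin.cons 1 (E j) : Fin (d + 1) → ℝ))
    (hP : ∀ q i, -q < -i → P q i = 0) (hP1 : ∀ q, P q q = 1)
    (hHM : H * (M : Matrix (Fin (d + 1)) (Fin (d + 1)) ℝ) =
      P * (u (E j) : Matrix (Fin (d + 1)) (Fin (d + 1)) ℝ))
    (hH : ∀ q, H q (π q) ≠ 0) : π 0 = j := by
  have hP0 : P 0 = Pi.single 0 1 := by
    funext i
    rcases eq_or_ne i 0 with rfl | hi
    · rw [hP1, Pi.single_eq_same]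
    · rw [Pi.single_eq_of_ne hi, hP 0 i]
      rw [neg_zero, Fin.pos_iff_ne_zero]
      exact neg_ne_zero.mpr hi
  have h1 : H 0 ᵥ* (M : Matrix (Fin (d + 1)) (Fin (d + 1)) ℝ) =
      P 0 ᵥ* (u (E j) : Matrix (Fin (d + 1)) (Fin (d + 1)) ℝ) := congrFun hHM 0
  -- Row `0` of `P * u (E j)` is `(1, E j)`, a multiple of row `j` of `M`.
  have h2 : H 0 = Pi.single j (δ j)⁻¹ := by
    refine vecMul_coordinate_injective (h1.trans ?_)
    rw [single_vecMul_coordinate hM, inv_mul_cancel₀ (hδ j), one_smul, vecMul_u, hP0]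
    congr 1
    funext r
    simp
  by_contra hne
  exact hH 0 (by rw [h2, Pi.single_eq_of_ne hne])

/-- If the last pivot belongs to a row outside of the range of the layers, then the points with
index `j` and with the last index agree in the coordinates of the layers. -/
theorem agree_of_pivot_last
    (hM : ∀ j, M j = δ j • (Fin.cons 1 (E j) : Fin (d + 1) → ℝ))
    (hP : ∀ q i, -q < -i → P q i = 0)
    (hHM : H * (M : Matrix (Fin (d + 1)) (Fin (d + 1)) ℝ) =
      P * (u (E j) : Matrix (Fin (d + 1)) (Fin (d + 1)) ℝ))
    (hH0 : ∀ q, ∀ c < π q, H q c = 0) (hδ : ∀ j, δ j ≠ 0)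
    (hH : ∀ q, H q (π q) ≠ 0) {q : Fin (d + 1)} (hq : π q = Fin.last d)
    {r : Fin d} (hr : r.succ < q) : E j r = E (Fin.last d) r := by
  have h1 : H q ᵥ* (M : Matrix (Fin (d + 1)) (Fin (d + 1)) ℝ) =
      P q ᵥ* (u (E j) : Matrix (Fin (d + 1)) (Fin (d + 1)) ℝ) := congrFun hHM q
  have h2 : H q = Pi.single (Fin.last d) (H q (π q)) := by
    funext c
    rcases eq_or_ne c (Fin.last d) with rfl | hc
    · rw [Pi.single_eq_same, hq]
    · rw [Pi.single_eq_of_ne hc, hH0 q c]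
      rw [hq]
      exact Fin.lt_last_iff_ne_last.mpr hc
  rw [h2, single_vecMul_coordinate hM, vecMul_u] at h1
  have e0 := congrFun h1 0
  have e1 := congrFun h1 r.succ
  have hPr : P q r.succ = 0 := by
    refine hP q r.succ (not_le.mp fun hle => ?_)
    rcases neg_le_neg_cases hle with h | ⟨-, h | h⟩
    · exact hr.ne h.symm
    · exact Fin.succ_ne_zero r h
    · exact absurd hr (not_lt.mpr h)
  simp only [Pi.smul_apply, Fin.cons_zero, Fin.cons_succ, smul_eq_mul, mul_one, hPr,
    add_zero] at e0 e1
  rw [← e0] at e1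
  exact (mul_left_cancel₀ (mul_ne_zero (hH q) (hδ _)) e1).symm

/-- The pivot of a row in the range of the layers is not the index of a point that agrees with the
point of index `j` in the coordinates of the layers. -/
theorem pivot_ne_of_agree
    (hM : ∀ j, M j = δ j • (Fin.cons 1 (E j) : Fin (d + 1) → ℝ))
    (hP : ∀ q i, -q < -i → P q i = 0) (hP1 : ∀ q, P q q = 1) (hPdet : P.det = 1)
    (hHM : H * (M : Matrix (Fin (d + 1)) (Fin (d + 1)) ℝ) =
      P * (u (E j) : Matrix (Fin (d + 1)) (Fin (d + 1)) ℝ))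
    (hH0 : ∀ q, ∀ c < π q, H q c = 0) (hδ : ∀ j, δ j ≠ 0)
    (hH : ∀ q, H q (π q) ≠ 0) {r₀ : Fin d} {j' : Fin (d + 1)}
    (hagree : ∀ r ≤ r₀, E j' r = E j r) : π r₀.succ ≠ j' := by
  intro hj'
  -- Chosen so that `y` times `u (E j)` is `(1, E j')`, which makes the combination `z` of the rows
  -- of `H` a multiple of the unit vector at `j'`.
  let y : Fin (d + 1) → ℝ := Fin.cons 1 fun r => E j' r - E j r
  obtain ⟨z, hz⟩ : ∃ z, z ᵥ* P = y := by
    refine ⟨y ᵥ* P⁻¹, ?_⟩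
    rw [vecMul_vecMul, nonsing_inv_mul _ (by rw [hPdet]; exact isUnit_one), vecMul_one]
  have hzH : z ᵥ* H = Pi.single j' (δ j')⁻¹ := by
    refine vecMul_coordinate_injective (M := M) ?_
    rw [vecMul_vecMul, hHM, ← vecMul_vecMul, hz, vecMul_u, single_vecMul_coordinate hM,
      inv_mul_cancel₀ (hδ j'), one_smul]
    congr 1
    funext r
    simp [y]
  have hz0 : z ≠ 0 := by
    rintro rfl
    have := congrFun hzH j'
    rw [zero_vecMul, Pi.single_eq_same] at this
    exact inv_ne_zero (hδ j') this.symm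
  obtain ⟨i₀, hi₀⟩ := Function.ne_iff.mp hz0
  have hne : (Finset.univ.filter fun q => z q ≠ 0).Nonempty := ⟨i₀, by simpa using hi₀⟩
  -- The smallest pivot in the support of `z` cannot cancel, so it is `j'` and `q = r₀ + 1`. The
  -- last support row `t` in the row order gives `y t = z t ≠ 0`, yet `1 ≤ t ≤ r₀ + 1`, where `y`
  -- vanishes by agreement.
  obtain ⟨q, hq, hqmin⟩ := Finset.exists_min_image _ π hne
  obtain ⟨t, ht, htmax⟩ := Finset.exists_max_image _ (fun q => -q) hne
  simp only [Finset.mem_filter, Finset.mem_univ, true_and] at hq hqmin ht htmax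
  have hval : (z ᵥ* H) (π q) = z q * H q (π q) := by
    rw [vecMul, dotProduct]
    refine Finset.sum_eq_single_of_mem q (Finset.mem_univ q) fun i _ hi => ?_
    by_cases hzi : z i = 0
    · rw [hzi, zero_mul]
    · rw [hH0 i, mul_zero]
      exact lt_of_le_of_ne (hqmin i hzi) fun h => hi (π.injective h).symm
  have hqj : π q = j' := by
    by_contra hcon
    rw [hzH, Pi.single_eq_of_ne hcon] at hval
    exact mul_ne_zero hq (hH q) hval.symm
  have hqr : q = r₀.succ := π.injective (hqj.trans hj'.symm)
  have hyt : y t = z t := by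
    rw [← hz, vecMul, dotProduct]
    rw [Finset.sum_eq_single_of_mem t (Finset.mem_univ t), hP1, mul_one]
    intro i _ hi
    by_cases hzi : z i = 0
    · rw [hzi, zero_mul]
    · rw [hP i t, mul_zero]
      exact lt_of_le_of_ne (htmax i hzi) fun h => hi (neg_injective h)
  have hle := htmax q hq
  rw [hqr] at hle
  have ht0 : t ≠ 0 ∧ t ≤ r₀.succ := by
    rcases neg_le_neg_cases hle with h | ⟨h, h' | h'⟩
    · exact ⟨h ▸ Fin.succ_ne_zero r₀, h.le⟩
    · exact absurd h' (Fin.succ_ne_zero r₀)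
    · exact ⟨h, h'⟩
  obtain ⟨r, rfl⟩ := Fin.exists_succ_eq.mpr ht0.1
  refine ht (hyt.symm.trans ?_)
  simp [y, hagree r (Fin.succ_le_succ_iff.mp ht0.2)]

end Pivots

/-! ### Nonvanishing of the zero weight component -/

section Main

variable {d k : ℕ} {V : Type*} [NormedAddCommGroup V] [NormedSpace ℝ V]
  {ρ : Representation ℝ SL(d + 1, ℝ) V}

theorem bddAbove_of_mem_torusWeight {m : Fin k → Fin (d + 1)} {T : ℕ → Fin k → ℝ}
    {x : Fin (d + 1) → ℝ} {v : V} (hv0 : v ≠ 0) (hv : v ∈ torusWeight ρ x)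
    (hb : v ∈ boundedSubmodule ρ m T) :
    BddAbove (Set.range fun i => ∑ r, layerCoeff m (T i) r * (x 0 - x r.succ)) := by
  obtain ⟨C, hC⟩ := hb
  refine ⟨C / ‖v‖, ?_⟩
  rintro _ ⟨i, rfl⟩
  have h1 := hC i
  rw [expLayer_eq, apply_diagSL_of_mem hv, dotProduct_layerExp, norm_smul, Real.norm_eq_abs,
    Real.abs_exp, ← le_div_iff₀ (norm_pos_iff.mpr hv0)] at h1
  exact ((Real.add_one_le_exp _).trans h1).trans' (by linarith)

variable [FiniteDimensional ℝ V]

theorem exists_torusWeight_sum (hρ : ∀ v : V, Continuous fun g => ρ g v) (v : V) :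
    ∃ (S : Finset (Fin (d + 1) → ℝ)) (w : (Fin (d + 1) → ℝ) → V),
      (∀ x ∈ S, w x ∈ torusWeight ρ x) ∧ (∀ x ∈ S, w x ≠ 0) ∧ ∑ x ∈ S, w x = v := by
  have hv : v ∈ ⨆ x, torusWeight ρ x := by rw [iSup_torusWeight_eq_top hρ]; trivial
  obtain ⟨f, hf, hsum⟩ := (Submodule.mem_iSup_iff_exists_finsupp _ _).mp hv
  exact ⟨f.support, f, fun x _ => hf x, fun x hx => Finsupp.mem_support_iff.mp hx, hsum⟩

/-- If the trajectories of the translates of a nonzero vector by the points of an affine basis are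
bounded, then these translates have nonzero components of weight zero. -/
theorem weightProj_ne_zero_of_bounded (hk : 1 ≤ k) {m : Fin k → Fin (d + 1)}
    (hm_pos : ∀ l, 0 < m l) {T : ℕ → Fin k → ℝ} (hT_nonneg : ∀ i l, 0 ≤ T i l)
    (hT : ∀ l, Tendsto (fun i => T i l) atTop atTop)
    (hρ : ∀ v : V, Continuous fun g => ρ g v)
    {E : Fin (d + 1) → Fin d → ℝ} (hE : AffineIndependent ℝ E) {v : V} (hv : v ≠ 0)
    (h : ∀ j, ρ (u (E j)) v ∈ boundedSubmodule ρ m T) :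
    weightProj ρ m 0 (ρ (u (E (Fin.last d))) v) ≠ 0 := by
  intro hzero
  obtain ⟨M, δ, hδ, hM⟩ := exists_coordinate_matrix hE
  obtain ⟨S, f, hf, hf0, hsum⟩ := exists_torusWeight_sum hρ (ρ M v)
  have hMv : ρ M v ≠ 0 := by
    intro h0
    refine hv ?_
    have : ρ (M⁻¹ * M) v = 0 := by rw [map_mul, Module.End.mul_apply, h0, map_zero]
    simpa using this
  have hSne : S.Nonempty := by
    by_contra hS
    rw [Finset.not_nonempty_iff_eq_empty] at hS
    rw [hS, Finset.sum_empty] at hsum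
    exact hMv hsum.symm
  obtain ⟨x, hxS, hxmax⟩ := Finset.exists_max_image S (fun x => x ⬝ᵥ fun c => (c : ℝ)) hSne
  have hcomm : ∀ y t, diagSL y * expLayer m t = expLayer m t * diagSL y := fun y t => by
    rw [expLayer_eq, ← diagSL_add, add_comm y, diagSL_add]
  -- Row reduction of the `j`-th translate.
  have key : ∀ j, ∃ (p g : SL(d + 1, ℝ)) (π : Equiv.Perm (Fin (d + 1))),
      (∀ q i, -q < -i → p q i = 0) ∧ (∀ q, p q q = 1) ∧
      (g : Matrix (Fin (d + 1)) (Fin (d + 1)) ℝ) * (M : Matrix (Fin (d + 1)) (Fin (d + 1)) ℝ) =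
        (p : Matrix (Fin (d + 1)) (Fin (d + 1)) ℝ) *
          (u (E j) : Matrix (Fin (d + 1)) (Fin (d + 1)) ℝ) ∧
      (∀ q, ∀ c < π q, g q c = 0) ∧ (∀ q, g q (π q) ≠ 0) ∧
      ρ g (∑ x ∈ S, f x) = ρ p (ρ (u (E j)) v) := by
    intro j
    obtain ⟨P, hPdet, hP, hP1, π, hπ⟩ := exists_echelon (Equiv.neg (Fin (d + 1)))
      (h := ((u (E j) * M⁻¹ : SL(d + 1, ℝ)) : Matrix (Fin (d + 1)) (Fin (d + 1)) ℝ))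
      (Matrix.SpecialLinearGroup.det_ne_zero _)
    let p : SL(d + 1, ℝ) := ⟨P, hPdet⟩
    refine ⟨p, p * (u (E j) * M⁻¹), π, hP, hP1, ?_, fun q => (hπ q).1, fun q => (hπ q).2, ?_⟩
    · rw [← Matrix.SpecialLinearGroup.coe_mul, ← Matrix.SpecialLinearGroup.coe_mul]
      exact congrArg _ (by group)
    · rw [hsum, ← Module.End.mul_apply, ← map_mul, ← Module.End.mul_apply, ← map_mul]
      congr 2
      group
  choose p g π hp hp1 hgM hg0 hg hgv using key
  have hπ0 : ∀ j, π j 0 = j := fun j => pivot_zero hδ hM (hp j) (hp1 j) (hgM j) (hg j)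
  have hpar : ∀ j, ∀ w ∈ boundedSubmodule ρ m T, ρ (p j) w ∈ boundedSubmodule ρ m T ∧
      (weightProj ρ m 0 w = 0 → weightProj ρ m 0 (ρ (p j) w) = 0) := by
    intro j w hw
    obtain ⟨p₀, hp₀, hlim⟩ := exists_tendsto_conj_expLayer hk hm_pos hT_nonneg hT (hp j)
    obtain ⟨h1, h2⟩ := weightProj_apply_of_tendsto_conj hρ hlim hp₀ hw
    exact ⟨h1, fun h0 => by rw [h2, h0, map_zero]⟩
  have hinj : ∀ (w : SL(d + 1, ℝ)), ρ w (f x) ≠ 0 := by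
    intro w h0
    refine hf0 x hxS ?_
    have : ρ (w⁻¹ * w) (f x) = 0 := by rw [map_mul, Module.End.mul_apply, h0, map_zero]
    simpa using this
  -- The pivots of the rows in the range of the layers carry maximal coordinates of the weight.
  have hlayer : ∀ j, (∀ c, x c ≤ x j) → ∀ r : Fin d, (∃ l, r.succ ≤ m l) →
      x (π j r.succ) = x j := by
    intro j hj r ⟨l, hl⟩
    obtain ⟨w, hw, hwZ⟩ := exists_monomial_apply_mem hρ (Z := boundedSubmodule ρ m T)
      (fun y z hz => apply_mem_boundedSubmodule_of_comm (hcomm y) hz) (hg0 j) hf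
      (by rw [hgv]; exact (hpar j _ (h j)).1) hxS hxmax
    obtain ⟨C, hC⟩ := bddAbove_of_mem_torusWeight (hinj w)
      (apply_monomial_mem_torusWeight hw (hf x hxS)) hwZ
    by_contra hne
    have hpos : 0 < x j - x (π j r.succ) := sub_pos.mpr (lt_of_le_of_ne (hj _) hne)
    have hlim : Tendsto (fun i => T i l * (x j - x (π j r.succ))) atTop atTop :=
      (hT l).atTop_mul_const hpos
    obtain ⟨i, hi⟩ := (hlim.eventually_gt_atTop C).exists
    have h1 := hC ⟨i, rfl⟩
    -- The exponent of the trajectory is a sum of nonnegative terms, one of which is at least `T i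
    -- l` times a positive constant, so it cannot stay bounded.
    simp only [Function.comp_apply, hπ0] at h1
    have h2 := Finset.single_le_sum (f := fun r => layerCoeff m (T i) r * (x j - x (π j r.succ)))
      (fun r _ => mul_nonneg (layerCoeff_nonneg m (hT_nonneg i) r) (sub_nonneg.mpr (hj _)))
      (Finset.mem_univ r)
    have h3 := mul_le_mul_of_nonneg_right (le_layerCoeff m (hT_nonneg i) hl) hpos.le
    linarith
  obtain ⟨j₀, hj₀⟩ := Finite.exists_max x
  obtain ⟨r₀, hr₀⟩ := Fin.exists_succ_eq.mpr (hm_pos ⟨0, hk⟩).ne'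
  have hlast : x (Fin.last d) = x j₀ := by
    by_contra hne
    have hagree : ∀ j, (∀ c, x c ≤ x j) → ∀ r : Fin d, (∃ l, r.succ ≤ m l) →
        E j r = E (Fin.last d) r := by
      intro j hj r ⟨l, hl⟩
      have hxj : x (Fin.last d) ≠ x j := fun h => hne (h.trans (le_antisymm (hj₀ j) (hj j₀)))
      refine agree_of_pivot_last hM (hp j) (hgM j) (hg0 j) hδ (hg j)
        (q := (π j).symm (Fin.last d)) (by simp) ?_
      rcases Fin.eq_zero_or_eq_succ ((π j).symm (Fin.last d)) with h0 | ⟨r', hr'⟩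
      · rw [Equiv.symm_apply_eq, hπ0] at h0
        exact absurd (congrArg x h0) hxj
      · rw [hr']
        by_contra hle
        have := hlayer j hj r' ⟨l, (not_lt.mp hle).trans hl⟩
        rw [← hr', Equiv.apply_symm_apply] at this
        exact hxj this
    -- The pivot of a layer row of `j₀` is itself an index of maximal coordinate, so its point and
    -- `E j₀` both agree with the last point.
    have hx' : x (π j₀ r₀.succ) = x j₀ := hlayer j₀ hj₀ r₀ ⟨_, hr₀.le⟩
    refine pivot_ne_of_agree hM (hp j₀) (hp1 j₀) (Matrix.SpecialLinearGroup.det_coe (p j₀)) (hgM j₀)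
      (hg0 j₀) hδ (hg j₀) (r₀ := r₀) (j' := π j₀ r₀.succ) (fun r hr => ?_) rfl
    have hl : ∃ l, r.succ ≤ m l := ⟨_, (Fin.succ_le_succ_iff.mpr hr).trans hr₀.le⟩
    rw [hagree _ (fun c => hx' ▸ hj₀ c) r hl, hagree j₀ hj₀ r hl]
  have hmax : ∀ c, x c ≤ x (Fin.last d) := fun c => hlast ▸ hj₀ c
  -- The vanishing of the zero weight component is carried along the degeneration by including it in
  -- the invariant subspace; the limit vector has weight zero for the layers.
  obtain ⟨w, hw, hwZ⟩ := exists_monomial_apply_mem hρ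
    (Z := boundedSubmodule ρ m T ⊓ LinearMap.ker (weightProj ρ m 0))
    (fun y z hz => ⟨apply_mem_boundedSubmodule_of_comm (hcomm y) hz.1, by
      rw [SetLike.mem_coe, LinearMap.mem_ker, weightProj_apply_comm hρ 0 (hcomm y), LinearMap.mem_ker.mp hz.2,
        map_zero]⟩) (hg0 (Fin.last d)) hf
    (by
      rw [hgv]
      exact ⟨(hpar _ _ (h _)).1, LinearMap.mem_ker.mpr ((hpar _ _ (h _)).2 hzero)⟩) hxS hxmax
  have hmem := torusWeight_le_weightSpace m _ (apply_monomial_mem_torusWeight hw (hf x hxS))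
  have hμ : (fun l => ∑ r : Fin d, if r.succ ≤ m l then
      (x ∘ π (Fin.last d)) 0 - (x ∘ π (Fin.last d)) r.succ else 0) = 0 := by
    funext l
    refine Finset.sum_eq_zero fun r _ => ?_
    split_ifs with hr
    · rw [Function.comp_apply, Function.comp_apply, hπ0, hlayer _ hmax r ⟨l, hr⟩, sub_self]
    · rfl
  rw [hμ] at hmem
  have := LinearMap.mem_ker.mp hwZ.2
  rw [weightProj_apply_of_mem hρ hmem] at this
  exact hinj w this

end Main

end Layered

theorem corollary4 {d k : ℕ} (hk : 1 ≤ k)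
    (m : Fin k → Fin (d + 1)) (hm : StrictAnti m) (hm_pos : ∀ l, 0 < m l)
    (T : ℕ → Fin k → ℝ) (hT_nonneg : ∀ i l, 0 ≤ T i l)
    (hT : ∀ l, Filter.Tendsto (fun i => T i l) Filter.atTop Filter.atTop)
    {V : Type*} [NormedAddCommGroup V] [NormedSpace ℝ V] [FiniteDimensional ℝ V]
    (ρ : Representation ℝ (Matrix.SpecialLinearGroup (Fin (d + 1)) ℝ) V)
    (hρ : ∀ v : V, Continuous fun g => ρ g v)
    (hV : DirectSum.IsInternal
      ![Layered.Vplus ρ m T, Layered.Vzero ρ m T, Layered.Vminus ρ m T])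
    {ι : Type*} (b : AffineBasis ι ℝ (Fin d → ℝ))
    (v : V) (hv : v ≠ 0)
    (h : ∀ e ∈ Set.range b, ρ (Layered.u e) v ∈ Layered.Vzero ρ m T ⊔ Layered.Vminus ρ m T) :
    ∀ e ∈ Set.range b,
      Layered.weightProj ρ m 0 (ρ (Layered.u e) v) ≠ 0 ∧
      Layered.neutralProj ρ m T (ρ (Layered.u e) v) ≠ 0 := by
  rintro _ ⟨i₀, rfl⟩
  have hweight : Layered.weightProj ρ m 0 (ρ (Layered.u (b i₀)) v) ≠ 0 := by
    classical
    have := b.finite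
    have := Fintype.ofFinite ι
    have hcard : Fintype.card ι = d + 1 := by
      rw [b.card_eq_finrank_add_one, Module.finrank_fin_fun]
    -- The numbering of the basis is free, so the chosen point may be placed last.
    obtain ⟨σ, hσ⟩ : ∃ σ : Fin (d + 1) ≃ ι, σ (Fin.last d) = i₀ := by
      let σ₀ : Fin (d + 1) ≃ ι := (Fintype.equivFinOfCardEq hcard).symm
      exact ⟨(Equiv.swap (Fin.last d) (σ₀.symm i₀)).trans σ₀, by simp⟩
    have := Layered.weightProj_ne_zero_of_bounded hk hm_pos hT_nonneg hT hρ
      (E := fun j => b (σ j)) (b.ind.comp_embedding σ.toEmbedding) hv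
      fun j => Layered.Vzero_sup_Vminus_le m T (h _ ⟨_, rfl⟩)
    simpa only [hσ] using this
  refine ⟨hweight, fun hneutral => hweight ?_⟩
  have hind := hV.submodule_iSupIndep
  have hcompl : IsCompl (Layered.Vzero ρ m T) (Layered.Vplus ρ m T ⊔ Layered.Vminus ρ m T) := by
    have hsup := hV.submodule_iSup_eq_top
    refine ⟨?_, ?_⟩
    · have := hind 1
      refine this.mono_right (sup_le ?_ ?_)
      · exact le_iSup₂_of_le (0 : Fin 3) (by decide) le_rfl
      · exact le_iSup₂_of_le (2 : Fin 3) (by decide) le_rfl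
    · rw [codisjoint_iff, eq_top_iff, ← hsup]
      refine iSup_le fun i => ?_
      fin_cases i
      · exact le_sup_left.trans le_sup_right
      · exact le_sup_left
      · exact le_sup_right.trans le_sup_right
  rw [Layered.neutralProj, Layered.projAlong, dif_pos hcompl,
    Submodule.projection_apply_eq_zero_iff] at hneutral
  -- If the neutral projection vanishes, the `V⁰` part lies in `V⁺ + V⁻` too and is zero, so the
  -- vector is in `V⁻` and has no zero weight component.
  obtain ⟨y₀, hy₀, y₁, hy₁, hy⟩ := Submodule.mem_sup.mp (h _ ⟨i₀, rfl⟩)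
  have hy₀' : y₀ ∈ Layered.Vplus ρ m T ⊔ Layered.Vminus ρ m T := by
    rw [eq_sub_of_add_eq hy]
    exact sub_mem hneutral (Submodule.mem_sup_right hy₁)
  rw [← hy, Submodule.disjoint_def.mp hcompl.disjoint y₀ hy₀ hy₀', zero_add]
  exact Layered.weightProj_zero_eq_zero_of_mem_Vminus hρ hy₁
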